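/- A finite nonincreasing sequence $\pi=(d_0\ge d_1\ge\cdots\ge d_{n-1})$ of nonnegative integers is called a tree degree sequence if it is the sequence of vertex degrees of some tree on $n$ vertices. For two tree degree sequences $\pi=(d_0,\dots,d_{n-1})$ and $\tau=(d_0',\dots,d_{n-1}')$ of the same length write $\pi\triangleleft\tau$ ($\tau$ majorizes $\pi$) if $\sum_{i=0}^{k}d_i\le\sum_{i=0}^{k}d_i'$ for all $0\le k\le n-1$, with equality for $k=n-1$. The greedy tree $T_\pi^*$ is the tree on vertices $v_0,\dots,v_{n-1}$ with degrees $d(v_i)=d_i$ built by breadth-first search: $v_0$ is the root and its children are $v_1,\dots,v_{d_0}$; then the vertices $v_1,v_2,\dots$ in turn each receive as children the next $d_i-1$ vertices of the list that do not have a parent yet. For a function $\psi$ from the positive integers to $\mathbb R$ and a tree $T$ let $$W_\psi(T)=\sum_{\{u,v\}\subseteq V(T),\,u\ne v}\psi(d(u,v)),$$ where $d(u,v)$ is the distance between $u$ and $v$ in $T$. Theorem. Let $\pi$ and $\tau$ be two different tree degree sequences of the same length with $\pi\triangleleft\tau$, and let $\psi$ be a nonnegative function on the positive integers. If $\psi$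 is strictly increasing, then $W_\psi(T_\pi^*)>W_\psi(T_\tau^*)$. If $\psi$ is strictly decreasing, then $W_\psi(T_\pi^*)<W_\psi(T_\tau^*)$. -/

import Mathlib

namespace GreedyTrees

/-- `d = (d₀, …, d_{n-1})` is a tree degree sequence: it is nonincreasing and it is the sequence of
vertex degrees of some tree (on the vertex set `{0, …, n-1}`). -/
def IsTreeDegreeSequence {n : ℕ} (d : Fin n → ℕ) : Prop :=
  Antitone d ∧
    ∃ G : SimpleGraph (Fin n), G.IsTree ∧ ∀ i : Fin n, (G.neighborSet i).ncard = d i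

/-- Majorization `x ◁ y` of two nonincreasing sequences of the same length: every partial sum of `x`
is at most the corresponding partial sum of `y`, and the total sums agree. (Only used for sequences
that are already arranged in nonincreasing order.) -/
def MajorizedBy {n : ℕ} (x y : Fin n → ℕ) : Prop :=
  (∀ k : ℕ, ∑ i : Fin n with i.val < k, x i ≤ ∑ i : Fin n with i.val < k, y i) ∧
    ∑ i : Fin n, x i = ∑ i : Fin n, y i

/-- The number of children of the vertex `i` in the greedy tree: the root `0` has `d₀` children, and
every other vertex `i` has `dᵢ - 1` children (its remaining neighbour is its parent). -/
def numChildren {n : ℕ} (d : Fin n → ℕ) (i : Fin n) : ℕ :=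
  if i.val = 0 then d i else d i - 1

/-- The index of the first vertex that is created after all the children of the vertices
`0, …, i-1` have been created: the root, and then the children of `0`, of `1`, …, of `i-1`. -/
def firstChild {n : ℕ} (d : Fin n → ℕ) (i : ℕ) : ℕ :=
  1 + ∑ k : Fin n with k.val < i, numChildren d k

/-- The greedy tree with degree sequence `d`, on the vertices `0, …, n-1` listed in breadth-first
order (layer by layer, and inside each layer from left to right). The root is `0`, its children
are `1, …, d₀`, and each further vertex `1, 2, 3, …` in turn receives as its children the next
`dᵢ - 1` vertices that have not been used yet. -/
def greedyTree {n : ℕ} (d : Fin n → ℕ) : SimpleGraph (Fin n) :=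
  SimpleGraph.fromRel fun i j : Fin n =>
    firstChild d i.val ≤ j.val ∧ j.val < firstChild d (i.val + 1)

/-- The distance between the two members of an unordered pair of vertices. -/
noncomputable def pairDist {V : Type*} (G : SimpleGraph V) : Sym2 V → ℕ :=
  Sym2.lift ⟨fun u v => G.dist u v, fun _ _ => G.dist_comm⟩

/-- `W_ψ(G)`: the sum of `ψ (d(u,v))` over all unordered pairs `{u, v}` of distinct vertices. -/
noncomputable def wienerPsi {V : Type*} [Fintype V] [DecidableEq V] (ψ : ℕ → ℝ)
    (G : SimpleGraph V) : ℝ :=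
  ∑ e : Sym2 V with ¬ e.IsDiag, ψ (pairDist G e)

end GreedyTrees

/-!
Write `G ≼ G'` (`PairsCloser`) if there is a bijection between the pairs of vertices of `G` and those
of `G'` that does not increase distances. The heart of the proof is that every tree `G` whose degree
sequence is majorized by `τ` satisfies `G ≼ greedyTree τ` (`pairsCloser_greedyTree`). Applied to a
tree realizing `π` this also shows that `greedyTree π` is a tree with degrees `π`, and applied to
`greedyTree π` it compares the two sums of `ψ` term by term. The inequality is strict because
otherwise the two greedy trees would have equally many pairs at distance two (`card_dist_two`), hence
equal sums of squared degrees, whereas strict majorization increases `∑ dᵢ²`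
(`MajorizedBy.sum_sq_lt`).

The tool for `G ≼ greedyTree τ` is a two-point rearrangement. Given vertices `a` and `b` of a tree,
reflect the part of the tree nearer to `a` onto the part nearer to `b` as far as the shapes allow:
this is an involution `σ` that reverses the geodesic from `a` to `b` and matches children of matched
vertices with each other (`IsReflection`). The polarization of the tree detaches every unmatched
branch hanging from a matched vertex `q` on the `b`-side and attaches it to `σ q`. Applying `σ` to
the other member of each pair with exactly one member in a moved branch is a bijection of pairs that
does not increase distances; this follows from three maps that send edges to edges or to vertices
(collapsing branches, reflecting, and folding). If the matching is maximal (`exists_saturated`), a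
matched pair of vertices keeps its two degrees or exchanges them. Forbidding one neighbour of `b` to
be matched moves one additional unit of degree from `b` to `a`.

Now label the tree and suppose that the vertices below `a` already have the same neighbours as in
the greedy tree. If `a` has too small a degree, polarize toward `a` from a vertex `b` with a larger
label: either `b` has larger degree than `a`, or `b` is chosen so that one unit of degree can be
moved from `b` to `a` without violating the majorization (`IsStage.raise`). In the breadth-first
order a vertex of the `b`-side that is in position is matched with a vertex of smaller label, so of
at least the same degree (`Agrees.map_lt`); hence the vertices in position are not disturbed
(`Agrees.polarize`). Once `a` has its degree, its children are relabelled (`IsStage.relabel`), and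
the next vertex is treated.
-/

namespace GreedyTrees

open SimpleGraph

section

/-! ### Directions and geodesics in trees -/

variable {V : Type*} {G : SimpleGraph V}

/-- The neighbour of `v` that is one step closer to `r`; the junk value is `v` itself, which for
connected `G` occurs only when `v = r`. -/
noncomputable def toward (G : SimpleGraph V) (r v : V) : V :=
  open Classical in
  if h : ∃ u, G.Adj v u ∧ G.dist r u + 1 = G.dist r v then h.choose else v

lemma toward_spec (hG : G.Connected) {r v : V} (h : v ≠ r) :
    G.Adj v (toward G r v) ∧ G.dist r (toward G r v) + 1 = G.dist r v := by
  have hex : ∃ u, G.Adj v u ∧ G.dist r u + 1 = G.dist r v := by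
    obtain ⟨p, hp⟩ := hG.exists_walk_length_eq_dist v r
    cases p with
    | nil => exact absurd rfl h
    | @cons _ u _ huv q =>
      refine ⟨u, huv, ?_⟩
      rw [Walk.length_cons, dist_comm] at hp
      have h1 := dist_le q
      rw [dist_comm] at h1
      have h2 := huv.symm.diff_dist_adj (u := r)
      omega
  unfold toward
  rw [dif_pos hex]
  exact hex.choose_spec

lemma toward_unique (hG : G.IsTree) {r v u w : V} (hu : G.Adj v u) (hw : G.Adj v w)
    (hdu : G.dist r u + 1 = G.dist r v) (hdw : G.dist r w + 1 = G.dist r v) : u = w := by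
  obtain ⟨p, hp, hpl⟩ := hG.connected.exists_path_of_dist r u
  obtain ⟨q, hq, hql⟩ := hG.connected.exists_path_of_dist r w
  have hnot : ∀ {x : V} (p : G.Walk r x), p.length < G.dist r v → v ∉ p.support := by
    classical
    intro x p hlt hmem
    have h1 := dist_le (p.takeUntil v hmem)
    have h2 := p.length_takeUntil_le_length hmem
    omega
  have h1 := hp.concat (hnot p (by omega)) hu.symm
  have h2 := hq.concat (hnot q (by omega)) hw.symm
  have h3 := congrArg Subtype.val ((hG.isAcyclic.subsingleton_path r v).elim ⟨_, h1⟩ ⟨_, h2⟩)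
  have h4 := congrArg Walk.penultimate h3
  simpa using h4

lemma eq_toward (hG : G.IsTree) {r v u : V} (hu : G.Adj v u)
    (hdu : G.dist r u + 1 = G.dist r v) : u = toward G r v := by
  have hne : v ≠ r := by
    rintro rfl
    simp at hdu
  obtain ⟨h1, h2⟩ := toward_spec hG.connected hne
  exact toward_unique hG hu h1 hdu h2

/-- In a tree every edge is traversed toward `r` in exactly one direction. -/
lemma adj_toward (hG : G.IsTree) (r : V) {u v : V} (h : G.Adj u v) :
    (v = toward G r u ∧ G.dist r v + 1 = G.dist r u) ∨
      (u = toward G r v ∧ G.dist r u + 1 = G.dist r v) := by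
  rcases hG.dist_eq_dist_add_one_of_adj r h with h1 | h1
  · exact Or.inl ⟨eq_toward hG h h1.symm, h1.symm⟩
  · exact Or.inr ⟨eq_toward hG h.symm h1.symm, h1.symm⟩

/-- `v` lies on the geodesic from `a` to `b`. -/
def OnGeodesic (G : SimpleGraph V) (a b v : V) : Prop :=
  G.dist a v + G.dist b v = G.dist a b

lemma OnGeodesic.symm {a b v : V} (h : OnGeodesic G a b v) : OnGeodesic G b a v := by
  unfold OnGeodesic at *
  rw [dist_comm (u := b) (v := a)]
  omega

lemma onGeodesic_left (a b : V) : OnGeodesic G a b a := by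
  simp [OnGeodesic, dist_comm]

lemma onGeodesic_right (a b : V) : OnGeodesic G a b b := by
  simp [OnGeodesic]

lemma OnGeodesic.toward_right (hG : G.Connected) {a b v : V} (h : OnGeodesic G a b v)
    (hv : v ≠ b) : OnGeodesic G a b (toward G b v) ∧
      G.dist a (toward G b v) = G.dist a v + 1 := by
  obtain ⟨h1, h2⟩ := toward_spec hG hv
  have h3 := hG.dist_triangle (u := a) (v := toward G b v) (w := b)
  rw [dist_comm (u := toward G b v) (v := b)] at h3
  have h4 := h1.diff_dist_adj (u := a)
  unfold OnGeodesic at *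
  omega

lemma OnGeodesic.toward_left (hG : G.Connected) {a b v : V} (h : OnGeodesic G a b v)
    (hv : v ≠ a) : OnGeodesic G a b (toward G a v) ∧
      G.dist b (toward G a v) = G.dist b v + 1 := by
  obtain ⟨h1, h2⟩ := h.symm.toward_right hG hv
  exact ⟨h1.symm, h2⟩

lemma OnGeodesic.eq_of_dist_eq (hG : G.IsTree) {a b v w : V} (hv : OnGeodesic G a b v)
    (hw : OnGeodesic G a b w) (h : G.dist a v = G.dist a w) : v = w := by
  induction hk : G.dist b v generalizing v w with
  | zero =>
    have h1 : G.dist b w = 0 := by unfold OnGeodesic at *; omega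
    rw [hG.connected.dist_eq_zero_iff] at hk h1
    rw [← hk, ← h1]
  | succ k ih =>
    have h1 : G.dist b w = k + 1 := by unfold OnGeodesic at *; omega
    have hvb : v ≠ b := by rintro rfl; simp at hk
    have hwb : w ≠ b := by rintro rfl; simp at h1
    obtain ⟨h2, h3⟩ := hv.toward_right hG.connected hvb
    obtain ⟨h4, h5⟩ := hw.toward_right hG.connected hwb
    obtain ⟨h6, h7⟩ := toward_spec hG.connected hvb
    obtain ⟨h8, h9⟩ := toward_spec hG.connected hwb
    have h10 : toward G b v = toward G b w := ih h2 h4 (by omega) (by omega)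
    refine toward_unique hG (r := a) h6.symm (h10 ▸ h8.symm) (by omega) ?_
    rw [h10]
    omega

/-- An edge that leads toward `b` and, reversed, toward `a` lies on the geodesic. -/
lemma onGeodesic_of_toward (hG : G.IsTree) {a b w y : V} (hadj : G.Adj w y)
    (hb : G.dist b y + 1 = G.dist b w) (ha : G.dist a w + 1 = G.dist a y) :
    OnGeodesic G a b w := by
  induction hk : G.dist a w generalizing w y with
  | zero =>
    rw [hG.connected.dist_eq_zero_iff] at hk
    exact hk ▸ onGeodesic_left a b
  | succ k ih =>
    have hwa : w ≠ a := by rintro rfl; simp at hk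
    obtain ⟨h1, h2⟩ := toward_spec hG.connected hwa
    rcases adj_toward hG b h1 with ⟨h3, h4⟩ | ⟨h3, h4⟩
    · have := toward_unique hG hadj h1 hb h4
      rw [← this] at h2
      omega
    · have h5 := ih h1.symm h4 h2 (by omega)
      unfold OnGeodesic at *
      omega

/-- `v` is strictly closer to `a` than to `b`. -/
def Near (G : SimpleGraph V) (a b v : V) : Prop := G.dist a v < G.dist b v

lemma Near.not_symm {a b v : V} (h : Near G a b v) : ¬ Near G b a v := by
  unfold Near at *; omega

lemma Near.ne_right {a b v : V} (h : Near G a b v) : v ≠ b := by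
  rintro rfl
  simp [Near] at h

lemma near_self (hG : G.Connected) {a b : V} (h : a ≠ b) : Near G a b a := by
  simpa [Near] using hG.pos_dist_of_ne h.symm

/-- Every edge at a vertex nearer to `a` than to `b` is oriented toward `b` by a vertex of that
kind. -/
lemma Near.adj (hG : G.IsTree) {a b u v : V} (h : Near G a b u) (hadj : G.Adj u v) :
    (v = toward G b u ∧ G.dist b v + 1 = G.dist b u) ∨
      (Near G a b v ∧ u = toward G b v ∧ G.dist b u + 1 = G.dist b v) := by
  rcases adj_toward hG b hadj with h1 | ⟨h1, h2⟩
  · exact Or.inl h1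
  · refine Or.inr ⟨?_, h1, h2⟩
    have := hadj.diff_dist_adj (u := a)
    unfold Near at *
    omega

lemma Near.crossing (hG : G.IsTree) {a b u : V} (h : Near G a b u)
    (hc : ¬ Near G a b (toward G b u)) : OnGeodesic G a b u ∧
      (G.dist b u = G.dist a u + 1 ∨ G.dist b u = G.dist a u + 2) := by
  obtain ⟨h1, h2⟩ := toward_spec hG.connected h.ne_right
  have h3 := hG.dist_eq_dist_add_one_of_adj a h1
  unfold Near at h hc
  exact ⟨onGeodesic_of_toward hG h1 h2 (by omega), by omega⟩

lemma Near.crossing_unique (hG : G.IsTree) {a b u v : V} (hu : Near G a b u) (hv : Near G a b v)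
    (hcu : ¬ Near G a b (toward G b u)) (hcv : ¬ Near G a b (toward G b v)) : u = v := by
  obtain ⟨h1, h2⟩ := hu.crossing hG hcu
  obtain ⟨h3, h4⟩ := hv.crossing hG hcv
  refine h1.eq_of_dist_eq hG h3 ?_
  unfold OnGeodesic at *
  omega

lemma Near.mid_edge (hG : G.IsTree) {a b u : V} (h : Near G a b u)
    (hc : Near G b a (toward G b u)) :
    toward G a (toward G b u) = u ∧ G.dist b u = G.dist a u + 1 := by
  obtain ⟨h1, h2⟩ := toward_spec hG.connected h.ne_right
  have h3 := hG.dist_eq_dist_add_one_of_adj a h1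
  unfold Near at h hc
  exact ⟨(eq_toward hG h1.symm (by omega)).symm, by omega⟩

/-- If `r` is not on the `a`-side, then on the `a`-side the directions toward `r` and toward `b`
agree. -/
lemma Near.toward_eq (hG : G.IsTree) {a b r p : V} (hp : Near G a b p) (hr : ¬ Near G a b r) :
    toward G r p = toward G b p := by
  induction hk : G.dist r p using Nat.strong_induction_on generalizing p with
  | _ k ih =>
    have hpr : p ≠ r := by rintro rfl; exact hr hp
    obtain ⟨h1, h2⟩ := toward_spec hG.connected hpr
    rcases hp.adj hG h1 with h3 | ⟨h3, h4, -⟩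
    · exact h3.1
    · have h5 := ih _ (by omega) h3 rfl
      have hwr : toward G r p ≠ r := by intro h; rw [h] at h3; exact hr h3
      obtain ⟨h6, h7⟩ := toward_spec hG.connected hwr
      rw [h5, ← h4] at h7
      omega

/-- If the crossing edge at `p` leads away from the `a`-side toward `r`, then `r` is not on the
`a`-side. -/
lemma Near.not_near_of_crossing (hG : G.IsTree) {a b r p v : V} (hp : Near G a b p)
    (hc : ¬ Near G a b (toward G b p)) (hv : ¬ Near G a b v) (hd : G.dist r v < G.dist r p) :
    ¬ Near G a b r := by
  induction hk : G.dist r v using Nat.strong_induction_on generalizing v with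
  | _ k ih =>
    by_cases hvr : v = r
    · exact hvr ▸ hv
    obtain ⟨h1, h2⟩ := toward_spec hG.connected hvr
    by_cases h3 : Near G a b (toward G r v)
    · rcases h3.adj hG h1.symm with h4 | h4
      · have h5 := h3.crossing_unique hG hp (h4.1 ▸ hv) hc
        rw [h5] at h2
        omega
      · exact absurd h4.1 hv
    · exact ih _ (by omega) h3 (by omega) rfl

end

section

/-! ### Partial reflections and polarization -/

variable {V : Type*} {G : SimpleGraph V}

/-- A partial reflection of the tree `G` exchanging `a` and `b`: an involution `σ` whose support
contains the geodesic from `a` to `b` (except a middle vertex), is closed under stepping toward the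
middle of that geodesic, and on which `σ` exchanges the vertices nearer to `a` with vertices nearer
to `b`, compatibly with the steps toward the middle. A vertex of one of the two sides is matched if
`σ` moves it. The vertices equidistant from `a` and `b` are fixed. -/
structure IsReflection (G : SimpleGraph V) (a b : V) (σ : V → V) : Prop where
  invol : ∀ v, σ (σ v) = v
  map_end : σ a = b
  swap_left : ∀ {v}, Near G a b v → σ v ≠ v → Near G b a (σ v)
  swap_right : ∀ {v}, Near G b a v → σ v ≠ v → Near G a b (σ v)
  moved : ∀ {v}, σ v ≠ v → Near G a b v ∨ Near G b a v
  parent_left : ∀ {v}, Near G a b v → σ v ≠ v → σ (toward G b v) = toward G a (σ v)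
  closed_left : ∀ {v}, Near G a b v → σ v ≠ v →
    Near G a b (toward G b v) ∨ Near G b a (toward G b v) → σ (toward G b v) ≠ toward G b v
  geod_left : ∀ {v}, OnGeodesic G a b v → Near G a b v → σ v ≠ v
  geod_right : ∀ {v}, OnGeodesic G a b v → Near G b a v → σ v ≠ v
  mid_left : ∀ {v}, Near G a b v → Near G b a (toward G b v) → σ v = toward G b v

namespace IsReflection

variable {a b : V} {σ : V → V}

lemma ne_iff (h : IsReflection G a b σ) {v : V} : σ (σ v) ≠ σ v ↔ σ v ≠ v := by
  rw [h.invol]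
  exact ne_comm

lemma symm (hG : G.IsTree) (h : IsReflection G a b σ) : IsReflection G b a σ where
  invol := h.invol
  map_end := by rw [← h.map_end, h.invol]
  swap_left := h.swap_right
  swap_right := h.swap_left
  moved hv := (h.moved hv).symm
  parent_left {v} hv hm := by
    have h1 := h.parent_left (h.swap_right hv hm) (h.ne_iff.2 hm)
    rw [h.invol] at h1
    rw [← h1, h.invol]
  closed_left {v} hv hm hn := by
    have h1 := h.parent_left (h.swap_right hv hm) (h.ne_iff.2 hm)
    have h2 := h.closed_left (h.swap_right hv hm) (h.ne_iff.2 hm)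
    rw [h.invol] at h1
    intro h3
    have h4 : toward G b (σ v) = toward G a v := by rw [← h.invol (toward G b (σ v)), h1, h3]
    rw [h4] at h2
    exact h2 hn.symm h3
  geod_left hv hn := h.geod_right hv.symm hn
  geod_right hv hn := h.geod_left hv.symm hn
  mid_left {v} hv hc := by
    obtain ⟨h1, -⟩ := hv.mid_edge hG hc
    have h2 := h.mid_left hc (h1.symm ▸ hv)
    rw [h1] at h2
    rw [← h.invol (toward G a v), h2]

lemma eq_of_not_near (h : IsReflection G a b σ) {v : V} (h1 : ¬ Near G a b v)
    (h2 : ¬ Near G b a v) : σ v = v := by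
  by_contra h3
  exact (h.moved h3).elim h1 h2

lemma crossing_left (hG : G.IsTree) (h : IsReflection G a b σ) {v : V} (hv : Near G a b v)
    (hc : ¬ Near G a b (toward G b v)) : σ v ≠ v :=
  h.geod_left (hv.crossing hG hc).1 hv

end IsReflection

/-- `v` is nearer to `a` than to `b` and not matched by the partial reflection `σ`. -/
def Unmatched (G : SimpleGraph V) (a b : V) (σ : V → V) (v : V) : Prop :=
  Near G a b v ∧ σ v = v

namespace IsReflection

variable {a b : V} {σ : V → V}

lemma adj_unmatched (hG : G.IsTree) (h : IsReflection G a b σ) {u v : V}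
    (hu : Unmatched G a b σ u) (hadj : G.Adj u v) :
    (v = toward G b u ∧ Near G a b v) ∨ (Unmatched G a b σ v ∧ u = toward G b v) := by
  rcases hu.1.adj hG hadj with ⟨h1, h2⟩ | ⟨h1, h2, h3⟩
  · refine Or.inl ⟨h1, ?_⟩
    by_contra h4
    exact h.crossing_left hG hu.1 (h1 ▸ h4) hu.2
  · refine Or.inr ⟨⟨h1, ?_⟩, h2⟩
    by_contra h4
    have := h.closed_left h1 h4
    rw [← h2] at this
    exact this (Or.inl hu.1) hu.2

/-- An unmatched branch is attached to the rest of the tree at a matched vertex of its side. -/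
lemma nbr_of_unmatched (hG : G.IsTree) (h : IsReflection G a b σ) {u v : V}
    (hu : Unmatched G a b σ u) (hadj : G.Adj u v) (hv : ¬ Unmatched G a b σ v) :
    Near G a b v ∧ σ v ≠ v ∧ v = toward G b u := by
  rcases h.adj_unmatched hG hu hadj with ⟨h1, h2⟩ | ⟨h1, -⟩
  · exact ⟨h2, fun h3 => hv ⟨h2, h3⟩, h1⟩
  · exact absurd h1 hv

lemma not_unmatched_of_ne {v : V} (h : σ v ≠ v) : ¬ Unmatched G a b σ v := fun h1 => h h1.2

lemma unmatched_map (h : IsReflection G a b σ) {v : V} :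
    Unmatched G a b σ (σ v) ↔ Unmatched G a b σ v := by
  by_cases h1 : σ v = v
  · rw [h1]
  · exact iff_of_false (not_unmatched_of_ne (h.ne_iff.2 h1)) (not_unmatched_of_ne h1)

/-- `σ` preserves adjacency away from the unmatched branches. -/
lemma adj_map (hG : G.IsTree) (h : IsReflection G a b σ) {u v : V} (hadj : G.Adj u v)
    (hu : ¬ Unmatched G a b σ u) (hv : ¬ Unmatched G a b σ v)
    (hu' : ¬ Unmatched G b a σ u) (hv' : ¬ Unmatched G b a σ v) : G.Adj (σ u) (σ v) := by
  have key : ∀ {a b u v : V}, IsReflection G a b σ → Near G a b u → ¬ Unmatched G a b σ u →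
      v = toward G b u → G.Adj (σ u) (σ v) := by
    intro a b u v h hn hu huv
    have hm : σ u ≠ u := fun h1 => hu ⟨hn, h1⟩
    rw [huv, h.parent_left hn hm]
    exact (toward_spec hG.connected (h.swap_left hn hm).ne_right).1
  by_cases h1 : Near G a b u
  · rcases h1.adj hG hadj with h2 | h2
    · exact key h h1 hu h2.1
    · exact (key h h2.1 hv h2.2.1).symm
  by_cases h2 : Near G b a u
  · rcases h2.adj hG hadj with h3 | h3
    · exact key (h.symm hG) h2 hu' h3.1
    · exact (key (h.symm hG) h3.1 hv' h3.2.1).symm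
  by_cases h3 : Near G a b v
  · rcases h3.adj hG hadj.symm with h4 | h4
    · exact (key h h3 hv h4.1).symm
    · exact absurd h4.1 h1
  by_cases h4 : Near G b a v
  · rcases h4.adj hG hadj.symm with h5 | h5
    · exact (key (h.symm hG) h4 hv' h5.1).symm
    · exact absurd h5.1 h2
  rwa [h.eq_of_not_near h1 h2, h.eq_of_not_near h3 h4]

end IsReflection

open Classical in
/-- The polarization of `G` along the partial reflection `σ`: every unmatched branch hanging from a
matched vertex `q` on the `b`-side is detached from `q` and attached to `σ q` on the `a`-side. -/
noncomputable def polarize (G : SimpleGraph V) (a b : V) (σ : V → V) : SimpleGraph V where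
  Adj u v := if (Unmatched G b a σ u ↔ Unmatched G b a σ v) then G.Adj u v
    else G.Adj (σ u) (σ v)
  symm := ⟨by
    intro u v huv
    by_cases h : Unmatched G b a σ u ↔ Unmatched G b a σ v
    · rw [if_pos h] at huv
      rw [if_pos h.symm]
      exact huv.symm
    · rw [if_neg h] at huv
      rw [if_neg (fun h1 => h h1.symm)]
      exact huv.symm⟩
  loopless := ⟨by intro u hu; simp at hu⟩

lemma polarize_adj_of_iff {a b u v : V} {σ : V → V}
    (h : Unmatched G b a σ u ↔ Unmatched G b a σ v) :
    (polarize G a b σ).Adj u v ↔ G.Adj u v := by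
  simp only [polarize, if_pos h]

lemma polarize_adj_of_not_iff {a b u v : V} {σ : V → V}
    (h : ¬ (Unmatched G b a σ u ↔ Unmatched G b a σ v)) :
    (polarize G a b σ).Adj u v ↔ G.Adj (σ u) (σ v) := by
  simp only [polarize, if_neg h]

/-- Iterates `f` from `v` until the predicate `U` fails, which happens because `μ` decreases. -/
noncomputable def collapse (U : V → Prop) (f : V → V) (μ : V → ℕ)
    (hμ : ∀ v, U v → μ (f v) < μ v) (v : V) : V :=
  open Classical in
  if h : U v then
    have := hμ v h
    collapse U f μ hμ (f v)
  else v
termination_by μ v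

lemma collapse_of_not {U : V → Prop} {f : V → V} {μ : V → ℕ} {hμ : ∀ v, U v → μ (f v) < μ v}
    {v : V} (h : ¬ U v) : collapse U f μ hμ v = v := by
  rw [collapse, dif_neg h]

lemma collapse_of {U : V → Prop} {f : V → V} {μ : V → ℕ} {hμ : ∀ v, U v → μ (f v) < μ v}
    {v : V} (h : U v) : collapse U f μ hμ v = collapse U f μ hμ (f v) := by
  rw [collapse, dif_pos h]

/-- A map that sends edges to edges or to single vertices does not increase distances. -/
lemma dist_le_of_lazy {V' : Type*} {G' : SimpleGraph V'} (hG : G.Connected) (f : V → V')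
    (hf : ∀ u v, G.Adj u v → f u = f v ∨ G'.Adj (f u) (f v)) (u v : V) :
    G'.Reachable (f u) (f v) ∧ G'.dist (f u) (f v) ≤ G.dist u v := by
  have key : ∀ {u v : V} (p : G.Walk u v), ∃ q : G'.Walk (f u) (f v), q.length ≤ p.length := by
    intro u v p
    induction p with
    | nil => exact ⟨Walk.nil, le_rfl⟩
    | @cons x y z h p ih =>
      obtain ⟨q, hq⟩ := ih
      rcases hf x y h with h1 | h1
      · exact ⟨q.copy h1.symm rfl, by rw [Walk.length_copy, Walk.length_cons]; omega⟩
      · exact ⟨Walk.cons h1 q, by rw [Walk.length_cons, Walk.length_cons]; omega⟩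
  obtain ⟨p, hp⟩ := hG.exists_walk_length_eq_dist u v
  obtain ⟨q, hq⟩ := key p
  exact ⟨q.reachable, (dist_le q).trans (hp ▸ hq)⟩

namespace IsReflection

variable {a b : V} {σ : V → V}

lemma dist_toward_lt (hG : G.Connected) (v : V) (hv : Unmatched G a b σ v) :
    G.dist b (toward G b v) < G.dist b v := by
  have := (toward_spec hG hv.1.ne_right).2
  omega

/-- Collapsing the unmatched branches of one side identifies the ends of their edges. -/
lemma collapse_eq_of_adj (hG : G.IsTree) (h : IsReflection G a b σ) {u v : V}
    (hadj : G.Adj u v) (hu : Unmatched G a b σ u) :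
    collapse (Unmatched G a b σ) (toward G b) (G.dist b) (dist_toward_lt hG.connected) u =
      collapse (Unmatched G a b σ) (toward G b) (G.dist b) (dist_toward_lt hG.connected) v := by
  rcases h.adj_unmatched hG hu hadj with ⟨h1, -⟩ | ⟨h1, h2⟩
  · rw [collapse_of hu, ← h1]
  · rw [collapse_of h1, ← h2]

/-- The reflection is an adjacency preserving map into the polarization away from the unmatched
branches of the `a`-side: the unmatched branches of the `b`-side move along with it. -/
lemma polarize_adj_map (hG : G.IsTree) (h : IsReflection G a b σ) {u v : V} (hadj : G.Adj u v)
    (hu : ¬ Unmatched G a b σ u) (hv : ¬ Unmatched G a b σ v) :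
    (polarize G a b σ).Adj (σ u) (σ v) := by
  have hs := h.symm hG
  by_cases h1 : Unmatched G b a σ u ↔ Unmatched G b a σ v
  · rw [polarize_adj_of_iff (by rw [hs.unmatched_map, hs.unmatched_map]; exact h1)]
    by_cases h2 : Unmatched G b a σ u
    · rwa [h2.2, (h1.1 h2).2]
    · exact h.adj_map hG hadj hu hv h2 (fun h3 => h2 (h1.2 h3))
  · rw [polarize_adj_of_not_iff (by rw [hs.unmatched_map, hs.unmatched_map]; exact h1),
      h.invol, h.invol]
    exact hadj

/-- Distances between vertices outside the moved branches do not grow. -/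
lemma dist_polarize_of_not (hG : G.IsTree) (h : IsReflection G a b σ) {u v : V}
    (hu : ¬ Unmatched G b a σ u) (hv : ¬ Unmatched G b a σ v) :
    (polarize G a b σ).Reachable u v ∧ (polarize G a b σ).dist u v ≤ G.dist u v := by
  have hs := h.symm hG
  have := dist_le_of_lazy (G' := polarize G a b σ) hG.connected
    (collapse (Unmatched G b a σ) (toward G a) (G.dist a) (dist_toward_lt hG.connected)) ?_ u v
  · rwa [collapse_of_not hu, collapse_of_not hv] at this
  intro u v hadj
  by_cases h1 : Unmatched G b a σ u
  · exact Or.inl (hs.collapse_eq_of_adj hG hadj h1)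
  by_cases h2 : Unmatched G b a σ v
  · exact Or.inl (hs.collapse_eq_of_adj hG hadj.symm h2).symm
  right
  rw [collapse_of_not h1, collapse_of_not h2]
  exact (polarize_adj_of_iff (iff_of_false h1 h2)).2 hadj

/-- Distances between vertices outside the unmatched `a`-branches do not grow if `σ` is applied to
both of them. -/
lemma dist_polarize_map (hG : G.IsTree) (h : IsReflection G a b σ) {u v : V}
    (hu : ¬ Unmatched G a b σ u) (hv : ¬ Unmatched G a b σ v) :
    (polarize G a b σ).Reachable (σ u) (σ v) ∧
      (polarize G a b σ).dist (σ u) (σ v) ≤ G.dist u v := by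
  have := dist_le_of_lazy (G' := polarize G a b σ) hG.connected
    (fun w => σ (collapse (Unmatched G a b σ) (toward G b) (G.dist b)
      (dist_toward_lt hG.connected) w)) ?_ u v
  · simpa only [collapse_of_not hu, collapse_of_not hv] using this
  intro u v hadj
  by_cases h1 : Unmatched G a b σ u
  · exact Or.inl (congrArg σ (h.collapse_eq_of_adj hG hadj h1))
  by_cases h2 : Unmatched G a b σ v
  · exact Or.inl (congrArg σ (h.collapse_eq_of_adj hG hadj.symm h2).symm)
  right
  simp only [collapse_of_not h1, collapse_of_not h2]
  exact h.polarize_adj_map hG hadj h1 h2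

open Classical in
/-- Folding the `b`-side onto the `a`-side brings the unmatched branches of both sides closer. -/
lemma dist_polarize_fold (hG : G.IsTree) (h : IsReflection G a b σ) (u v : V) :
    (polarize G a b σ).Reachable (if Near G b a u then σ u else u)
        (if Near G b a v then σ v else v) ∧
      (polarize G a b σ).dist (if Near G b a u then σ u else u)
        (if Near G b a v then σ v else v) ≤ G.dist u v := by
  refine dist_le_of_lazy (G' := polarize G a b σ) hG.connected
    (fun w => if Near G b a w then σ w else w) ?_ u v
  have hs := h.symm hG
  have key : ∀ u v, Near G b a u → v = toward G a u → G.Adj u v →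
      (if Near G b a u then σ u else u) = (if Near G b a v then σ v else v) ∨
      (polarize G a b σ).Adj (if Near G b a u then σ u else u)
        (if Near G b a v then σ v else v) := by
    intro u v hu huv hadj
    rw [if_pos hu]
    by_cases h1 : Near G a b v
    · left
      rw [if_neg h1.not_symm, huv]
      exact hs.mid_left hu (huv ▸ h1)
    · right
      have h2 := h.polarize_adj_map hG hadj (fun h3 => hu.not_symm h3.1) (fun h3 => h1 h3.1)
      by_cases h3 : Near G b a v
      · rwa [if_pos h3]
      · rw [if_neg h3]
        rwa [h.eq_of_not_near h1 h3] at h2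
  intro u v hadj
  by_cases h1 : Near G b a u
  · rcases h1.adj hG hadj with h2 | h2
    · exact key u v h1 h2.1 hadj
    · exact (key v u h2.1 h2.2.1 hadj.symm).imp Eq.symm Adj.symm
  by_cases h2 : Near G b a v
  · rcases h2.adj hG hadj.symm with h3 | h3
    · exact (key v u h2 h3.1 hadj.symm).imp Eq.symm Adj.symm
    · exact absurd h3.1 h1
  right
  simp only [if_neg h1, if_neg h2]
  exact (polarize_adj_of_iff (iff_of_false (fun h => h1 h.1) (fun h => h2 h.1))).2 hadj

open Classical in
/-- The permutation of pairs along which polarization does not increase distances: if exactly one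
member of the pair lies in a moved branch, the other one is reflected. -/
noncomputable def pairMap (G : SimpleGraph V) (a b : V) (σ : V → V) (e : V × V) : V × V :=
  if (Unmatched G b a σ e.1 ↔ Unmatched G b a σ e.2) then e else (σ e.1, σ e.2)

lemma pairMap_invol (hG : G.IsTree) (h : IsReflection G a b σ) :
    Function.Involutive (pairMap G a b σ) := by
  intro e
  have hs := h.symm hG
  by_cases h1 : Unmatched G b a σ e.1 ↔ Unmatched G b a σ e.2
  · rw [pairMap, pairMap, if_pos h1, if_pos h1]
  · have h2 : pairMap G a b σ e = (σ e.1, σ e.2) := by rw [pairMap, if_neg h1]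
    rw [h2, pairMap, if_neg (by rwa [hs.unmatched_map, hs.unmatched_map]), h.invol, h.invol]

lemma dist_polarize_pairMap (hG : G.IsTree) (h : IsReflection G a b σ) (e : V × V) :
    (polarize G a b σ).Reachable (pairMap G a b σ e).1 (pairMap G a b σ e).2 ∧
      (polarize G a b σ).dist (pairMap G a b σ e).1 (pairMap G a b σ e).2 ≤ G.dist e.1 e.2 := by
  obtain ⟨u, v⟩ := e
  have hYX : ∀ {w}, Unmatched G b a σ w → ¬ Unmatched G a b σ w := fun h1 h2 =>
    h1.1.not_symm h2.1
  have key : ∀ u v, Unmatched G b a σ u → ¬ Unmatched G b a σ v →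
      (polarize G a b σ).Reachable (σ u) (σ v) ∧
      (polarize G a b σ).dist (σ u) (σ v) ≤ G.dist u v := by
    intro u v hu hv
    by_cases hw : Unmatched G a b σ v
    · have := h.dist_polarize_fold hG u v
      rw [if_pos hu.1, if_neg hw.1.not_symm] at this
      rwa [hw.2]
    · exact h.dist_polarize_map hG (hYX hu) hw
  by_cases hu : Unmatched G b a σ u <;> by_cases hv : Unmatched G b a σ v
  · have := h.dist_polarize_map hG (hYX hu) (hYX hv)
    simpa only [pairMap, hu, hv, if_true, hu.2, hv.2] using this
  · simpa only [pairMap, hu, hv, iff_false, not_true, if_false] using key u v hu hv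
  · obtain ⟨h1, h2⟩ := key v u hv hu
    simp only [pairMap, hu, hv, iff_true, if_false]
    exact ⟨h1.symm, by rwa [SimpleGraph.dist_comm, SimpleGraph.dist_comm (u := u)]⟩
  · simpa only [pairMap, hu, hv, if_true] using h.dist_polarize_of_not hG hu hv

lemma polarize_connected (hG : G.IsTree) (h : IsReflection G a b σ) :
    (polarize G a b σ).Connected := by
  have := hG.connected.nonempty
  refine Connected.mk fun u v => ?_
  have := (h.dist_polarize_pairMap hG (pairMap G a b σ (u, v))).1
  rwa [h.pairMap_invol hG] at this

end IsReflection

/-- The vertices of `G` can be paired up with those of `G'` so that distances do not grow. -/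
def PairsCloser {V' : Type*} (G : SimpleGraph V) (G' : SimpleGraph V') : Prop :=
  ∃ Φ : V × V ≃ V' × V', ∀ e, G'.dist (Φ e).1 (Φ e).2 ≤ G.dist e.1 e.2

lemma PairsCloser.trans {V' V'' : Type*} {G' : SimpleGraph V'} {G'' : SimpleGraph V''}
    (h : PairsCloser G G') (h' : PairsCloser G' G'') : PairsCloser G G'' := by
  obtain ⟨Φ, hΦ⟩ := h
  obtain ⟨Ψ, hΨ⟩ := h'
  exact ⟨Φ.trans Ψ, fun e => (hΨ _).trans (hΦ e)⟩

lemma PairsCloser.refl (G : SimpleGraph V) : PairsCloser G G :=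
  ⟨Equiv.refl _, fun _ => le_rfl⟩

lemma IsReflection.pairsCloser (hG : G.IsTree) {a b : V} {σ : V → V}
    (h : IsReflection G a b σ) : PairsCloser G (polarize G a b σ) :=
  ⟨(h.pairMap_invol hG).toPerm, fun e => (h.dist_polarize_pairMap hG e).2⟩

lemma pairsCloser_of_iso {V' : Type*} {G' : SimpleGraph V'} (hG : G.Connected) (f : G ≃g G') :
    PairsCloser G G' :=
  ⟨f.toEquiv.prodCongr f.toEquiv, fun e =>
    (dist_le_of_lazy hG f (fun _ _ h => Or.inr (f.map_adj_iff.2 h)) e.1 e.2).2⟩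

end

section

variable {V : Type*} {G : SimpleGraph V}

/-! ### Existence of saturated reflections -/

lemma exists_onGeodesic (hG : G.Connected) (a b : V) {i : ℕ} (hi : i ≤ G.dist a b) :
    ∃ w, OnGeodesic G a b w ∧ G.dist a w = i := by
  induction i with
  | zero => exact ⟨a, onGeodesic_left a b, dist_self⟩
  | succ i ih =>
    obtain ⟨w, h1, h2⟩ := ih (by omega)
    have hwb : w ≠ b := by rintro rfl; omega
    obtain ⟨h3, h4⟩ := h1.toward_right hG hwb
    exact ⟨_, h3, by omega⟩

/-- Reversing the geodesic from `a` to `b` is a partial reflection. -/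
lemma exists_isReflection (hG : G.IsTree) (a b : V) :
    ∃ σ, IsReflection G a b σ ∧ ∀ v, ¬ OnGeodesic G a b v → σ v = v := by
  classical
  choose g hg hga using fun (i : ℕ) (hi : i ≤ G.dist a b) =>
    exists_onGeodesic hG.connected a b hi
  have hle : ∀ {v}, OnGeodesic G a b v → G.dist b v ≤ G.dist a b := by
    intro v hv; unfold OnGeodesic at hv; omega
  obtain ⟨σ, hσ, hσ'⟩ : ∃ σ : V → V,
      (∀ v, OnGeodesic G a b v → OnGeodesic G a b (σ v) ∧ G.dist a (σ v) = G.dist b v) ∧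
      ∀ v, ¬ OnGeodesic G a b v → σ v = v := by
    refine ⟨fun v => if h : OnGeodesic G a b v then g _ (hle h) else v, ?_, ?_⟩
    · intro v hv
      simp only [dif_pos hv]
      exact ⟨hg _ _, hga _ _⟩
    · intro v hv
      simp only [dif_neg hv]
  have hdb : ∀ v, OnGeodesic G a b v → G.dist b (σ v) = G.dist a v := by
    intro v hv
    have := hσ v hv
    unfold OnGeodesic at *
    omega
  have hfix : ∀ v, OnGeodesic G a b v → (σ v = v ↔ G.dist a v = G.dist b v) := by
    intro v hv
    constructor
    · intro h
      rw [← (hσ v hv).2, h]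
    · intro h
      exact (hσ v hv).1.eq_of_dist_eq hG hv (by rw [(hσ v hv).2, h])
  have hon : ∀ {v}, σ v ≠ v → OnGeodesic G a b v := fun {v} h => by
    by_contra h1
    exact h (hσ' v h1)
  have hne : ∀ v, OnGeodesic G a b v → Near G a b v ∨ Near G b a v → σ v ≠ v := by
    intro v hv h1 h2
    rw [hfix v hv] at h2
    unfold Near at h1
    omega
  have hpar : ∀ v, OnGeodesic G a b v → Near G a b v →
      σ (toward G b v) = toward G a (σ v) := by
    intro v hv hn
    obtain ⟨h1, h2⟩ := hv.toward_right hG.connected hn.ne_right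
    have h3 := hσ v hv
    have hne : σ v ≠ a := by
      intro h
      rw [h, dist_self] at h3
      unfold Near at hn
      omega
    obtain ⟨h4, h5⟩ := h3.1.toward_left hG.connected hne
    refine (hσ _ h1).1.eq_of_dist_eq hG h4 ?_
    have h6 := hdb v hv
    rw [(hσ _ h1).2]
    have h7 := h3.1
    unfold OnGeodesic at *
    omega
  refine ⟨σ, ⟨?_, ?_, ?_, ?_, ?_, ?_, ?_, ?_, ?_, ?_⟩, hσ'⟩
  · intro v
    by_cases hv : OnGeodesic G a b v
    · have h1 := hσ v hv
      exact (hσ _ h1.1).1.eq_of_dist_eq hG hv (by rw [(hσ _ h1.1).2, hdb v hv])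
    · rw [hσ' v hv, hσ' v hv]
  · have h1 := hσ a (onGeodesic_left a b)
    exact h1.1.eq_of_dist_eq hG (onGeodesic_right a b) (by rw [h1.2, dist_comm])
  · intro v hn hm
    have := hσ v (hon hm)
    have := hdb v (hon hm)
    unfold Near at *
    omega
  · intro v hn hm
    have := hσ v (hon hm)
    have := hdb v (hon hm)
    unfold Near at *
    omega
  · intro v hm
    have h1 := hon hm
    rw [ne_eq, hfix v h1] at hm
    unfold Near
    omega
  · intro v hn hm
    exact hpar v (hon hm) hn
  · intro v hn hm h1
    exact hne _ ((hon hm).toward_right hG.connected hn.ne_right).1 h1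
  · intro v hv hn
    exact hne v hv (Or.inl hn)
  · intro v hv hn
    exact hne v hv (Or.inr hn)
  · intro v hn hc
    have h0 := hn.crossing hG hc.not_symm
    have h1 := h0.1.toward_right hG.connected hn.ne_right
    refine (hσ v h0.1).1.eq_of_dist_eq hG h1.1 ?_
    rw [(hσ v h0.1).2, h1.2]
    exact (hn.mid_edge hG hc).2

/-- Two unmatched neighbours of a matched pair can be matched with each other. -/
lemma IsReflection.extend [DecidableEq V] (hG : G.IsTree) {a b : V} {σ : V → V}
    (h : IsReflection G a b σ) {p c c' : V} (hp : Near G a b p) (hpm : σ p ≠ p)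
    (hpc : G.Adj p c) (hc : Unmatched G a b σ c) (hpc' : G.Adj (σ p) c')
    (hc' : Unmatched G b a σ c') :
    IsReflection G a b (fun v => if v = c then c' else if v = c' then c else σ v) := by
  have hs := h.symm hG
  have hcc : c ≠ c' := by
    rintro rfl
    exact hc.1.not_symm hc'.1
  have htc : p = toward G b c :=
    (h.nbr_of_unmatched hG hc hpc.symm (not_unmatched_of_ne hpm)).2.2
  have htc' : σ p = toward G a c' :=
    (hs.nbr_of_unmatched hG hc' hpc'.symm (not_unmatched_of_ne (h.ne_iff.2 hpm))).2.2
  obtain ⟨σ', hσ'⟩ : ∃ σ' : V → V,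
      σ' = fun v => if v = c then c' else if v = c' then c else σ v := ⟨_, rfl⟩
  have e1 : σ' c = c' := by simp [hσ']
  have e2 : σ' c' = c := by simp [hσ', hcc.symm]
  have e3 : ∀ v, v ≠ c → v ≠ c' → σ' v = σ v := by
    intro v h1 h2
    simp [hσ', h1, h2]
  have n1 : ∀ {v}, σ v ≠ v → v ≠ c := by rintro v h1 rfl; exact h1 hc.2
  have n2 : ∀ {v}, σ v ≠ v → v ≠ c' := by rintro v h1 rfl; exact h1 hc'.2
  have e4 : ∀ {v}, σ v ≠ v → σ' v = σ v := fun h1 => e3 _ (n1 h1) (n2 h1)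
  rw [← hσ']
  have hcases : ∀ {v}, σ' v ≠ v → v = c ∨ v = c' ∨ σ v ≠ v := by
    intro v hv
    by_cases h1 : v = c
    · exact Or.inl h1
    by_cases h2 : v = c'
    · exact Or.inr (Or.inl h2)
    rw [e3 v h1 h2] at hv
    exact Or.inr (Or.inr hv)
  have hmono : ∀ {v}, σ v ≠ v → σ' v ≠ v := fun h1 => by rwa [e4 h1]
  constructor
  · intro v
    by_cases h1 : v = c
    · rw [h1, e1, e2]
    by_cases h2 : v = c'
    · rw [h2, e2, e1]
    by_cases h3 : σ v = v
    · rw [e3 v h1 h2, h3, e3 v h1 h2, h3]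
    · rw [e4 h3, e4 (h.ne_iff.2 h3), h.invol]
  · have h1 : σ a ≠ a := by
      intro h1
      have h2 : a = b := h1.symm.trans h.map_end
      subst h2
      unfold Near at hp
      omega
    rw [e4 h1, h.map_end]
  · intro v hn hm
    rcases hcases hm with h1 | h1 | h1
    · rw [h1, e1]; exact hc'.1
    · exact absurd hn (h1 ▸ hc'.1.not_symm)
    · rw [e4 h1]; exact h.swap_left hn h1
  · intro v hn hm
    rcases hcases hm with h1 | h1 | h1
    · exact absurd hn (h1 ▸ hc.1.not_symm)
    · rw [h1, e2]; exact hc.1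
    · rw [e4 h1]; exact h.swap_right hn h1
  · intro v hm
    rcases hcases hm with h1 | h1 | h1
    · exact Or.inl (h1 ▸ hc.1)
    · exact Or.inr (h1 ▸ hc'.1)
    · exact h.moved h1
  · intro v hn hm
    rcases hcases hm with h1 | h1 | h1
    · rw [h1, e1, ← htc, e4 hpm, htc']
    · exact absurd hn (h1 ▸ hc'.1.not_symm)
    · rw [e4 h1, ← h.parent_left hn h1]
      refine e3 _ ?_ ?_
      · intro h2
        exact h.closed_left hn h1 (Or.inl (h2 ▸ hc.1)) (h2 ▸ hc.2)
      · intro h2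
        exact h.closed_left hn h1 (Or.inr (h2 ▸ hc'.1)) (h2 ▸ hc'.2)
  · intro v hn hm h0
    rcases hcases hm with h1 | h1 | h1
    · rw [h1, ← htc]; exact hmono hpm
    · exact absurd hn (h1 ▸ hc'.1.not_symm)
    · exact hmono (h.closed_left hn h1 h0)
  · intro v hv hn
    exact hmono (h.geod_left hv hn)
  · intro v hv hn
    exact hmono (h.geod_right hv hn)
  · intro v hn h0
    have h1 : σ v ≠ v := h.crossing_left hG hn h0.not_symm
    rw [e4 h1]
    exact h.mid_left hn h0

/-- A partial reflection fixing a prescribed set `F` can be chosen saturated: two vertices matched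
with each other do not both have unmatched neighbours outside `F`. -/
lemma exists_saturated [Finite V] (hG : G.IsTree) (a b : V) (F : Set V)
    (hF : ∀ c ∈ F, ¬ OnGeodesic G a b c) :
    ∃ σ, IsReflection G a b σ ∧ (∀ c ∈ F, σ c = c) ∧
      ∀ p c c', Near G a b p → σ p ≠ p → G.Adj p c → Unmatched G a b σ c → G.Adj (σ p) c' →
        Unmatched G b a σ c' → c ∈ F ∨ c' ∈ F := by
  classical
  have := Fintype.ofFinite V
  obtain ⟨σ₀, h₀, h₀'⟩ := exists_isReflection hG a b
  have : Nonempty {σ : V → V // IsReflection G a b σ ∧ ∀ c ∈ F, σ c = c} :=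
    ⟨⟨σ₀, h₀, fun c hc => h₀' c (hF c hc)⟩⟩
  obtain ⟨⟨σ, hσ, hσF⟩, hmax⟩ := Finite.exists_max
    (fun σ : {σ : V → V // IsReflection G a b σ ∧ ∀ c ∈ F, σ c = c} =>
      (Finset.univ.filter fun v => σ.1 v ≠ v).card)
  refine ⟨σ, hσ, hσF, ?_⟩
  intro p c c' hp hpm hpc hc hpc' hc'
  by_contra hcon
  rw [not_or] at hcon
  have hne : ∀ v ∈ F, v ≠ c ∧ v ≠ c' := by
    intro v hv
    exact ⟨fun h => hcon.1 (h ▸ hv), fun h => hcon.2 (h ▸ hv)⟩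
  have h1 := hmax ⟨_, hσ.extend hG hp hpm hpc hc hpc' hc', fun v hv => by
    simp [(hne v hv).1, (hne v hv).2, hσF v hv]⟩
  refine absurd h1 (not_le.2 (Finset.card_lt_card ?_))
  rw [Finset.ssubset_iff_of_subset]
  · refine ⟨c, ?_, by simp [hc.2]⟩
    have : c' ≠ c := by
      rintro rfl
      exact hc.1.not_symm hc'.1
    simp [this]
  · intro v hv
    simp only [Finset.mem_filter, Finset.mem_univ, true_and] at hv ⊢
    rw [if_neg, if_neg]
    · exact hv
    · rintro rfl; exact hv hc'.2
    · rintro rfl; exact hv hc.2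

/-! ### Degrees after polarization -/

open Classical in
/-- The degree of `v`, with decidability of adjacency taken from classical logic. -/
noncomputable def deg [Fintype V] (G : SimpleGraph V) (v : V) : ℕ :=
  (Finset.univ.filter (G.Adj v)).card

lemma deg_eq_ncard [Fintype V] (G : SimpleGraph V) (v : V) : deg G v = (G.neighborSet v).ncard := by
  classical
  rw [deg, ← Set.ncard_coe_finset]
  congr 1
  ext w
  simp

lemma sum_deg [Fintype V] (G : SimpleGraph V) :
    ∑ v, deg G v = 2 * Nat.card G.edgeSet := by
  classical
  have h := G.sum_degrees_eq_twice_card_edges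
  rw [Nat.card_eq_fintype_card, ← edgeFinset_card, ← h]
  refine Finset.sum_congr rfl fun v _ => ?_
  rw [deg, ← card_neighborFinset_eq_degree]
  congr 1
  ext w
  simp

lemma isTree_iff_sum_deg [Fintype V] :
    G.IsTree ↔ G.Connected ∧ ∑ v, deg G v + 2 = 2 * Fintype.card V := by
  rw [isTree_iff_connected_and_card, sum_deg, Nat.card_eq_fintype_card (α := V)]
  refine and_congr_right fun _ => ?_
  omega

open Classical in
/-- The number of unmatched neighbours of `v`. -/
noncomputable def extra [Fintype V] (G : SimpleGraph V) (a b : V) (σ : V → V) (v : V) : ℕ :=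
  (Finset.univ.filter fun w => G.Adj v w ∧ (Unmatched G a b σ w ∨ Unmatched G b a σ w)).card

lemma extra_pos [Fintype V] {a b : V} {σ : V → V} {v : V} (h : extra G a b σ v ≠ 0) :
    ∃ w, G.Adj v w ∧ (Unmatched G a b σ w ∨ Unmatched G b a σ w) := by
  unfold extra at h
  obtain ⟨w, hw⟩ := Finset.card_ne_zero.1 h
  exact ⟨w, by simpa using hw⟩

namespace IsReflection

variable [Fintype V] {a b : V} {σ : V → V}

lemma deg_add_extra (hG : G.IsTree) (h : IsReflection G a b σ) {v : V} (hv : σ v ≠ v) :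
    deg G v + extra G a b σ (σ v) = deg G (σ v) + extra G a b σ v := by
  classical
  have hs := h.symm hG
  have hle : ∀ v, σ v ≠ v →
      (Finset.univ.filter fun w => G.Adj v w ∧
        ¬ (Unmatched G a b σ w ∨ Unmatched G b a σ w)).card ≤
      (Finset.univ.filter fun w => G.Adj (σ v) w ∧
        ¬ (Unmatched G a b σ w ∨ Unmatched G b a σ w)).card := by
    intro v hv
    refine Finset.card_le_card_of_injOn σ ?_ ?_
    · intro w hw
      simp only [Finset.coe_filter, Finset.mem_univ, true_and, Set.mem_ofPred_eq, not_or] at hw ⊢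
      rw [h.unmatched_map, hs.unmatched_map]
      exact ⟨h.adj_map hG hw.1 (not_unmatched_of_ne hv) hw.2.1 (not_unmatched_of_ne hv) hw.2.2,
        hw.2⟩
    · intro x _ y _ hxy
      rw [← h.invol x, ← h.invol y, hxy]
  have hsplit : ∀ v, deg G v = extra G a b σ v + (Finset.univ.filter fun w => G.Adj v w ∧
        ¬ (Unmatched G a b σ w ∨ Unmatched G b a σ w)).card := by
    intro v
    unfold deg extra
    rw [← Finset.filter_filter, ← Finset.filter_filter,
      Finset.card_filter_add_card_filter_not]
  have h1 := hle v hv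
  have h2 := hle (σ v) (h.ne_iff.2 hv)
  rw [h.invol] at h2
  have h3 := hsplit v
  have h4 := hsplit (σ v)
  omega

lemma deg_polarize_of_eq (hG : G.IsTree) (h : IsReflection G a b σ) {v : V} (hv : σ v = v) :
    deg (polarize G a b σ) v = deg G v := by
  classical
  unfold deg
  by_cases hu : Unmatched G b a σ v
  · refine Finset.card_nbij' σ σ ?_ ?_ (fun w _ => h.invol w) (fun w _ => h.invol w)
    · intro w hw
      simp only [Finset.coe_filter, Finset.mem_univ, true_and, Set.mem_ofPred_eq] at hw ⊢
      by_cases h1 : Unmatched G b a σ w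
      · rw [polarize_adj_of_iff (iff_of_true hu h1)] at hw
        rwa [h1.2]
      · rw [polarize_adj_of_not_iff (by simp [hu, h1]), hv] at hw
        exact hw
    · intro w hw
      simp only [Finset.coe_filter, Finset.mem_univ, true_and, Set.mem_ofPred_eq] at hw ⊢
      by_cases h1 : Unmatched G b a σ w
      · rw [h1.2]
        exact (polarize_adj_of_iff (iff_of_true hu h1)).2 hw
      · rw [polarize_adj_of_not_iff (by simp [hu, (h.symm hG).unmatched_map, h1]), hv, h.invol]
        exact hw
  · congr 1
    ext w
    simp only [Finset.mem_filter, Finset.mem_univ, true_and]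
    by_cases h1 : Unmatched G b a σ w
    · rw [polarize_adj_of_not_iff (by simp [hu, h1]), hv, h1.2]
    · rw [polarize_adj_of_iff (iff_of_false hu h1)]

lemma deg_polarize_left (hG : G.IsTree) (h : IsReflection G a b σ) {p : V}
    (hp : Near G a b p) (hm : σ p ≠ p) :
    deg (polarize G a b σ) p = deg G p + extra G a b σ (σ p) := by
  classical
  have hs := h.symm hG
  have hup := not_unmatched_of_ne (G := G) (a := b) (b := a) hm
  unfold deg extra
  rw [← Finset.card_union_of_disjoint]
  · congr 1
    ext w
    simp only [Finset.mem_filter, Finset.mem_univ, true_and, Finset.mem_union]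
    by_cases h1 : Unmatched G b a σ w
    · rw [polarize_adj_of_not_iff (by simp [hup, h1]), h1.2]
      have : ¬ G.Adj p w := fun h2 =>
        (hs.nbr_of_unmatched hG h1 h2.symm hup).1.not_symm hp
      simp [this, h1]
    · rw [polarize_adj_of_iff (iff_of_false hup h1)]
      have : G.Adj (σ p) w → ¬ Unmatched G a b σ w := fun h2 h3 =>
        (h.nbr_of_unmatched hG h3 h2.symm (not_unmatched_of_ne (h.ne_iff.2 hm))).1.not_symm
          (h.swap_left hp hm)
      simp only [h1, or_false]
      tauto
  · rw [Finset.disjoint_filter]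
    rintro w - h1 ⟨h2, h3 | h3⟩
    · exact (h.nbr_of_unmatched hG h3 h2.symm (not_unmatched_of_ne (h.ne_iff.2 hm))).1.not_symm
        (h.swap_left hp hm)
    · exact (hs.nbr_of_unmatched hG h3 h1.symm hup).1.not_symm hp

lemma deg_polarize_right (hG : G.IsTree) (h : IsReflection G a b σ) {q : V}
    (hq : Near G b a q) (hm : σ q ≠ q) :
    deg (polarize G a b σ) q + extra G a b σ q = deg G q := by
  classical
  have hs := h.symm hG
  have huq := not_unmatched_of_ne (G := G) (a := b) (b := a) hm
  have : deg (polarize G a b σ) q = ((Finset.univ.filter (G.Adj q)).filter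
      fun w => ¬ (Unmatched G a b σ w ∨ Unmatched G b a σ w)).card := by
    unfold deg
    congr 1
    ext w
    simp only [Finset.mem_filter, Finset.mem_univ, true_and]
    by_cases h1 : Unmatched G b a σ w
    · rw [polarize_adj_of_not_iff (by simp [huq, h1]), h1.2]
      have : ¬ G.Adj (σ q) w := fun h2 =>
        (hs.nbr_of_unmatched hG h1 h2.symm (not_unmatched_of_ne (h.ne_iff.2 hm))).1.not_symm
          (h.swap_right hq hm)
      simp [this, h1]
    · rw [polarize_adj_of_iff (iff_of_false huq h1)]
      have : G.Adj q w → ¬ Unmatched G a b σ w := fun h2 h3 =>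
        (h.nbr_of_unmatched hG h3 h2.symm (not_unmatched_of_ne hm)).1.not_symm hq
      tauto
  rw [this]
  unfold deg extra
  rw [← Finset.filter_filter, add_comm, Finset.card_filter_add_card_filter_not]

lemma deg_polarize_add (hG : G.IsTree) (h : IsReflection G a b σ) (v : V) :
    deg (polarize G a b σ) v + deg (polarize G a b σ) (σ v) = deg G v + deg G (σ v) := by
  by_cases hm : σ v = v
  · rw [hm, h.deg_polarize_of_eq hG hm]
  have key : ∀ v, σ v ≠ v → Near G a b v →
      deg (polarize G a b σ) v + deg (polarize G a b σ) (σ v) = deg G v + deg G (σ v) := by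
    intro v hm h1
    have h2 := h.deg_polarize_left hG h1 hm
    have h3 := h.deg_polarize_right hG (h.swap_left h1 hm) (h.ne_iff.2 hm)
    omega
  rcases h.moved hm with h1 | h1
  · exact key v hm h1
  · have := key (σ v) (h.ne_iff.2 hm) (h.swap_right h1 hm)
    rw [h.invol] at this
    omega

end IsReflection

/-- Sums over a finite type can be compared after symmetrization by an involution. -/
lemma sum_le_of_invol [Fintype V] {σ : V → V} (hσ : ∀ v, σ (σ v) = v) {f g k : V → ℕ}
    (h : ∀ v, f v + f (σ v) ≤ g v + g (σ v) + k v) :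
    2 * ∑ v, f v ≤ 2 * ∑ v, g v + ∑ v, k v := by
  have hre : ∀ f : V → ℕ, ∑ v, f (σ v) = ∑ v, f v := fun f =>
    Equiv.sum_comp (Function.Involutive.toPerm σ hσ) f
  have h1 := Finset.sum_le_sum (s := Finset.univ) fun v _ => h v
  simp only [Finset.sum_add_distrib, hre] at h1
  omega

lemma IsReflection.polarize_isTree [Fintype V] {a b : V} {σ : V → V} (hG : G.IsTree)
    (h : IsReflection G a b σ) : (polarize G a b σ).IsTree := by
  rw [isTree_iff_sum_deg]
  refine ⟨h.polarize_connected hG, ?_⟩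
  have h1 := (isTree_iff_sum_deg.1 hG).2
  have h2 := sum_le_of_invol (k := fun _ => 0) h.invol fun v => (h.deg_polarize_add hG v).le
  have h3 := sum_le_of_invol (k := fun _ => 0) h.invol fun v => (h.deg_polarize_add hG v).ge
  simp only [Finset.sum_const_zero] at h2 h3
  omega

end

section

/-! ### Two kinds of polarization steps -/

variable {V : Type*} {G : SimpleGraph V}

namespace IsReflection

variable [Fintype V] {a b : V} {σ : V → V}

/-- If two vertices matched with each other do not both have unmatched neighbours, then at least
one of them has none. -/
lemma extra_eq_zero_or (hG : G.IsTree) (h : IsReflection G a b σ) {p : V} (hp : Near G a b p)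
    (hm : σ p ≠ p) (hsat : ∀ c c', G.Adj p c → Unmatched G a b σ c → G.Adj (σ p) c' →
      Unmatched G b a σ c' → False) :
    extra G a b σ p = 0 ∨ extra G a b σ (σ p) = 0 := by
  by_contra hcon
  rw [not_or] at hcon
  have hs := h.symm hG
  obtain ⟨c, h1, h2⟩ := extra_pos hcon.1
  obtain ⟨c', h3, h4⟩ := extra_pos hcon.2
  have h5 : Unmatched G a b σ c := h2.resolve_right fun h5 =>
    (hs.nbr_of_unmatched hG h5 h1.symm (not_unmatched_of_ne hm)).1.not_symm hp
  have h6 : Unmatched G b a σ c' := h4.resolve_left fun h6 =>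
    (h.nbr_of_unmatched hG h6 h3.symm (not_unmatched_of_ne (h.ne_iff.2 hm))).1.not_symm
      (h.swap_left hp hm)
  exact hsat c c' h1 h5 h3 h6

/-- At a matched pair one of whose members has no unmatched neighbours, polarization either keeps
the two degrees or exchanges them. -/
lemma sum_deg_polarize_of_extra (hG : G.IsTree) (h : IsReflection G a b σ) {p : V}
    (hp : Near G a b p) (hm : σ p ≠ p)
    (hz : extra G a b σ p = 0 ∨ extra G a b σ (σ p) = 0) (φ : ℕ → ℕ) :
    φ (deg (polarize G a b σ) p) + φ (deg (polarize G a b σ) (σ p)) =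
      φ (deg G p) + φ (deg G (σ p)) := by
  have h1 := h.deg_polarize_left hG hp hm
  have h2 := h.deg_polarize_right hG (h.swap_left hp hm) (h.ne_iff.2 hm)
  have h3 := h.deg_add_extra hG hm
  rcases hz with h4 | h4
  · have h5 : deg (polarize G a b σ) p = deg G (σ p) := by omega
    have h6 : deg (polarize G a b σ) (σ p) = deg G p := by omega
    rw [h5, h6, add_comm]
  · have h5 : deg (polarize G a b σ) p = deg G p := by omega
    have h6 : deg (polarize G a b σ) (σ p) = deg G (σ p) := by omega
    rw [h5, h6]

/-- If `σ p` has unmatched neighbours and `p` has none, then `σ p` has the larger degree. -/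
lemma deg_lt_of_moved (hG : G.IsTree) (h : IsReflection G a b σ) {p c : V}
    (hm : σ p ≠ p) (hz : extra G a b σ p = 0 ∨ extra G a b σ (σ p) = 0)
    (hc : Unmatched G b a σ c) (hadj : G.Adj (σ p) c) : deg G p < deg G (σ p) := by
  classical
  have h3 := h.deg_add_extra hG hm
  have h4 : extra G a b σ (σ p) ≠ 0 := by
    unfold extra
    exact Finset.card_ne_zero.2 ⟨c, by simp [hadj, hc]⟩
  omega

end IsReflection

/-- A polarization step that exchanges the degrees of `a` and `b`, and possibly those of other
matched pairs. -/
lemma exists_reflection_swap [Fintype V] (hG : G.IsTree) {a b : V} (hdeg : deg G a < deg G b) :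
    ∃ σ, IsReflection G a b σ ∧ deg G a < deg (polarize G a b σ) a ∧
      (∀ φ : ℕ → ℕ, ∑ v, φ (deg (polarize G a b σ) v) ≤ ∑ v, φ (deg G v)) ∧
      ∀ p c, Near G a b p → σ p ≠ p → Unmatched G b a σ c → G.Adj (σ p) c →
        deg G p < deg G (σ p) := by
  have hab : a ≠ b := by rintro rfl; omega
  obtain ⟨σ, h, -, hsat⟩ := exists_saturated hG a b ∅ (by simp)
  have hz : ∀ p, Near G a b p → σ p ≠ p →
      extra G a b σ p = 0 ∨ extra G a b σ (σ p) = 0 := fun p hp hm =>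
    h.extra_eq_zero_or hG hp hm fun c c' h1 h2 h3 h4 => by simpa using hsat p c c' hp hm h1 h2 h3 h4
  refine ⟨σ, h, ?_, ?_, fun p c hp hm hc hadj => h.deg_lt_of_moved hG hm (hz p hp hm) hc hadj⟩
  · have ha := near_self hG.connected hab
    have hm : σ a ≠ a := by rw [h.map_end]; exact hab.symm
    have h1 := h.deg_polarize_left hG ha hm
    have h2 := h.deg_add_extra hG hm
    rw [h.map_end] at h1 h2
    omega
  · intro φ
    have hkey : ∀ v, φ (deg (polarize G a b σ) v) + φ (deg (polarize G a b σ) (σ v)) ≤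
        φ (deg G v) + φ (deg G (σ v)) + 0 := by
      intro v
      by_cases hm : σ v = v
      · rw [hm, h.deg_polarize_of_eq hG hm, add_zero]
      rcases h.moved hm with h1 | h1
      · exact (h.sum_deg_polarize_of_extra hG h1 hm (hz v h1 hm) φ).le
      · have h2 := h.swap_right h1 hm
        have h3 := h.ne_iff.2 hm
        have := h.sum_deg_polarize_of_extra hG h2 h3 (hz _ h2 h3) φ
        rw [h.invol] at this
        omega
    have := sum_le_of_invol (k := fun _ => 0) h.invol hkey
    simp only [Finset.sum_const_zero] at this
    omega

/-- A polarization step that moves exactly one branch from `b` to `a`, where `b` does not have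
larger degree than `a`; the branch is obtained by forbidding one neighbour of `b` to be matched. -/
lemma exists_reflection_shift [Fintype V] (hG : G.IsTree) {a b : V} (hab : a ≠ b)
    (hdeg : deg G b ≤ deg G a) (hb : 2 ≤ deg G b) :
    ∃ σ, IsReflection G a b σ ∧ deg G a < deg (polarize G a b σ) a ∧
      (∀ t : ℕ, ∑ v, (deg (polarize G a b σ) v - t) ≤
        ∑ v, (deg G v - t) + if deg G b ≤ t ∧ t ≤ deg G a then 1 else 0) ∧
      ∀ p c, p ≠ a → Near G a b p → σ p ≠ p → Unmatched G b a σ c → G.Adj (σ p) c →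
        deg G p < deg G (σ p) := by
  classical
  obtain ⟨c₀, hc₀, hc₀'⟩ : ∃ c₀, G.Adj b c₀ ∧ c₀ ≠ toward G a b := by
    obtain ⟨x, hx, y, hy, hxy⟩ := Finset.one_lt_card.1 (show 1 < deg G b by omega)
    simp only [Finset.mem_filter, Finset.mem_univ, true_and] at hx hy
    by_cases h : x = toward G a b
    · exact ⟨y, hy, fun h' => hxy (h.trans h'.symm)⟩
    · exact ⟨x, hx, h⟩
  have hbn := near_self hG.connected hab.symm
  obtain ⟨hc1, hc2, hc3⟩ : Near G b a c₀ ∧ b = toward G a c₀ ∧ G.dist a b + 1 = G.dist a c₀ :=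
    (hbn.adj hG hc₀).resolve_left fun h => hc₀' h.1
  obtain ⟨σ, h, hF, hsat⟩ := exists_saturated hG a b {c₀} (by
    rintro c rfl h
    unfold OnGeodesic at h
    omega)
  have hs := h.symm hG
  have hU₀ : Unmatched G b a σ c₀ := ⟨hc1, hF _ rfl⟩
  have ha := near_self hG.connected hab
  have hma : σ a ≠ a := by rw [h.map_end]; exact hab.symm
  have hba : σ b = a := hs.map_end
  have hz : ∀ p, p ≠ a → Near G a b p → σ p ≠ p →
      extra G a b σ p = 0 ∨ extra G a b σ (σ p) = 0 := by
    intro p hpa hp hm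
    refine h.extra_eq_zero_or hG hp hm fun c c' h1 h2 h3 h4 => ?_
    rcases hsat p c c' hp hm h1 h2 h3 h4 with rfl | rfl
    · exact h2.1.not_symm hc1
    · have h5 := (hs.nbr_of_unmatched hG h4 h3.symm (IsReflection.not_unmatched_of_ne (h.ne_iff.2 hm))).2.2
      rw [← hc2, ← h.map_end] at h5
      exact hpa (by rw [← h.invol p, h5, h.invol])
  have hex : extra G a b σ b = 1 := by
    refine le_antisymm ?_ ?_
    · by_contra hlt
      obtain ⟨x, hx, y, hy, hxy⟩ := Finset.one_lt_card.1 (not_le.1 hlt)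
      obtain ⟨c', h1, h2, h3⟩ : ∃ c', c' ≠ c₀ ∧ G.Adj b c' ∧
          (Unmatched G a b σ c' ∨ Unmatched G b a σ c') := by
        simp only [Finset.mem_filter, Finset.mem_univ, true_and] at hx hy
        by_cases hxc : x = c₀
        · exact ⟨y, fun h' => hxy (hxc.trans h'.symm), hy⟩
        · exact ⟨x, hxc, hx⟩
      have h3' : Unmatched G b a σ c' := h3.resolve_left fun h6 =>
        (h.nbr_of_unmatched hG h6 h2.symm
          (IsReflection.not_unmatched_of_ne (by rw [hba]; exact hab))).1.not_symm hbn
      have h4 : extra G a b σ a = 0 := by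
        by_contra h4
        obtain ⟨c, h5, h6⟩ := extra_pos h4
        have h7 : Unmatched G a b σ c := h6.resolve_right fun h8 =>
          (hs.nbr_of_unmatched hG h8 h5.symm (IsReflection.not_unmatched_of_ne hma)).1.not_symm ha
        rcases hsat a c c' ha hma h5 h7 (by rwa [h.map_end]) h3' with rfl | h8
        · exact h7.1.not_symm hc1
        · exact h1 h8
      have h5 := h.deg_add_extra hG hma
      rw [h.map_end] at h5
      omega
    · unfold extra
      exact Finset.card_pos.2 ⟨c₀, by simp [hc₀, hU₀]⟩
  have hda : deg (polarize G a b σ) a = deg G a + 1 := by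
    rw [h.deg_polarize_left hG ha hma, h.map_end, hex]
  have hdb : deg (polarize G a b σ) b + 1 = deg G b := by
    have := h.deg_polarize_right hG hbn (by rw [hba]; exact hab)
    rwa [hex] at this
  refine ⟨σ, h, by omega, ?_,
    fun p c hpa hp hm hc hadj => h.deg_lt_of_moved hG hm (hz p hpa hp hm) hc hadj⟩
  intro t
  have hkey : ∀ v, (deg (polarize G a b σ) v - t) + (deg (polarize G a b σ) (σ v) - t) ≤
      (deg G v - t) + (deg G (σ v) - t) +
        if v = a ∨ v = b then (if deg G b ≤ t ∧ t ≤ deg G a then 1 else 0) else 0 := by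
    intro v
    by_cases hva : v = a
    · rw [hva, h.map_end, if_pos (Or.inl rfl)]
      split_ifs <;> omega
    by_cases hvb : v = b
    · rw [hvb, hba, if_pos (Or.inr rfl)]
      split_ifs <;> omega
    rw [if_neg (by simp [hva, hvb]), add_zero]
    by_cases hm : σ v = v
    · rw [hm, h.deg_polarize_of_eq hG hm]
    rcases h.moved hm with h1 | h1
    · exact (h.sum_deg_polarize_of_extra hG h1 hm (hz v hva h1 hm) (· - t)).le
    · have h2 := h.swap_right h1 hm
      have h3 := h.ne_iff.2 hm
      have h4 : σ v ≠ a := fun h4 => hvb (by rw [← h.invol v, h4, h.map_end])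
      have := h.sum_deg_polarize_of_extra hG h2 h3 (hz _ h4 h2 h3) (· - t)
      rw [h.invol] at this
      omega
  have h1 := sum_le_of_invol h.invol hkey
  have h2 : ∑ v, (if v = a ∨ v = b then (if deg G b ≤ t ∧ t ≤ deg G a then 1 else 0) else 0) =
      2 * if deg G b ≤ t ∧ t ≤ deg G a then 1 else 0 := by
    rw [← Finset.sum_filter, Finset.sum_const, smul_eq_mul]
    congr 1
    rw [Finset.card_eq_two]
    exact ⟨a, b, hab, by ext; simp⟩
  rw [h2] at h1
  omega

/-- Polarization does not change the adjacencies of a set of vertices no member of which is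
involved in a moved edge. -/
lemma IsReflection.polarize_adj_iff (hG : G.IsTree) {a b : V} {σ : V → V}
    (h : IsReflection G a b σ) {S : V → Prop}
    (hS : ∀ p c, Near G a b p → σ p ≠ p → Unmatched G b a σ c → G.Adj (σ p) c →
      ¬ S p ∧ ¬ S (σ p) ∧ ¬ S c) {i : V} (hi : S i) (j : V) :
    (polarize G a b σ).Adj i j ↔ G.Adj i j := by
  have hs := h.symm hG
  have key : ∀ c v, Unmatched G b a σ c → ¬ Unmatched G b a σ v → G.Adj c v →
      ¬ S c ∧ ¬ S v ∧ ¬ S (σ v) := by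
    intro c v hc hv hadj
    obtain ⟨h1, h2, -⟩ := hs.nbr_of_unmatched hG hc hadj hv
    have h3 := hS (σ v) c (h.swap_right h1 h2) (h.ne_iff.2 h2) hc (by rw [h.invol]; exact hadj.symm)
    rw [h.invol] at h3
    exact ⟨h3.2.2, h3.2.1, h3.1⟩
  by_cases h1 : Unmatched G b a σ i ↔ Unmatched G b a σ j
  · exact polarize_adj_of_iff h1
  rw [polarize_adj_of_not_iff h1]
  by_cases h2 : Unmatched G b a σ i
  · have h3 : ¬ Unmatched G b a σ j := by tauto
    rw [h2.2]
    exact iff_of_false (fun h4 => (key i (σ j) h2 (by rwa [hs.unmatched_map]) h4).1 hi)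
      (fun h4 => (key i j h2 h3 h4).1 hi)
  · have h3 : Unmatched G b a σ j := by tauto
    rw [h3.2]
    refine iff_of_false (fun h4 => ?_) (fun h4 => (key j i h3 h2 h4.symm).2.1 hi)
    have := (key j (σ i) h3 (by rwa [hs.unmatched_map]) h4.symm).2.2
    rw [h.invol] at this
    exact this hi

end

section

/-! ### The breadth-first structure of greedy trees -/

/-- The numerical conditions on `τ` that make the breadth-first construction of the greedy tree
work. -/
structure IsBalanced {n : ℕ} (τ : Fin n → ℕ) : Prop where
  anti : Antitone τ
  pos : ∀ i, 1 ≤ τ i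
  sum : ∑ i, τ i + 2 = 2 * n

variable {n : ℕ} {τ : Fin n → ℕ}

lemma firstChild_zero (τ : Fin n → ℕ) : firstChild τ 0 = 1 := by
  simp [firstChild]

lemma firstChild_succ (τ : Fin n → ℕ) (i : Fin n) :
    firstChild τ (i.val + 1) = firstChild τ i.val + numChildren τ i := by
  have : (Finset.univ.filter fun k : Fin n => k.val < i.val + 1) =
      insert i (Finset.univ.filter fun k : Fin n => k.val < i.val) := by
    ext k
    simp only [Finset.mem_filter, Finset.mem_univ, true_and, Finset.mem_insert, Fin.ext_iff]
    omega
  rw [firstChild, this, Finset.sum_insert (by simp), firstChild]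
  omega

lemma firstChild_mono (τ : Fin n → ℕ) : Monotone (firstChild τ) := by
  intro i j hij
  unfold firstChild
  gcongr 1 + ?_
  refine Finset.sum_le_sum_of_subset fun k hk => ?_
  simp only [Finset.mem_filter, Finset.mem_univ, true_and] at hk ⊢
  omega

lemma IsBalanced.firstChild_card (h : IsBalanced τ) : firstChild τ n = n := by
  have h1 : ∀ i : Fin n, numChildren τ i + (if i.val = 0 then 0 else 1) = τ i := by
    intro i
    have := h.pos i
    unfold numChildren
    split_ifs <;> omega
  have h2 : ∑ i : Fin n, (numChildren τ i + (if i.val = 0 then 0 else 1)) = ∑ i, τ i :=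
    Finset.sum_congr rfl fun i _ => h1 i
  rw [Finset.sum_add_distrib] at h2
  have h3 := h.sum
  have hn : 0 < n := by
    by_contra h0
    have : n = 0 := by omega
    subst this
    simp at h3
  have h4 : ∑ i : Fin n, (if i.val = 0 then 0 else 1) = n - 1 := by
    obtain ⟨k, rfl⟩ : ∃ k, n = k + 1 := ⟨n - 1, by omega⟩
    rw [Fin.sum_univ_succ]
    simp
  have h5 : firstChild τ n = 1 + ∑ i, numChildren τ i := by
    unfold firstChild
    congr 1
    exact Finset.sum_congr (by ext k; simp) fun _ _ => rfl
  omega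

/-- In the breadth-first order every vertex is created before its first child. -/
lemma IsBalanced.lt_firstChild (h : IsBalanced τ) {i : ℕ} (hi : i < n) : i < firstChild τ i := by
  induction i with
  | zero => rw [firstChild_zero]; exact Nat.one_pos
  | succ i ih =>
    have h1 := ih (by omega)
    have h2 := firstChild_succ τ ⟨i, by omega⟩
    simp only at h2
    by_cases h3 : numChildren τ ⟨i, by omega⟩ = 0
    · have h4 : ∀ k : Fin n, i ≤ k.val → numChildren τ k = 0 := by
        intro k hk
        have h5 := h.anti (show (⟨i, by omega⟩ : Fin n) ≤ k from hk)
        have h6 := h.pos ⟨i, by omega⟩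
        unfold numChildren at h3 ⊢
        simp only at h3
        split_ifs at h3 ⊢ <;> omega
      have h5 : firstChild τ (i + 1) = firstChild τ n := by
        unfold firstChild
        congr 1
        refine Finset.sum_subset (fun k hk => ?_) fun k _ hk => h4 k ?_
        · simp
        · simp only [Finset.mem_filter, Finset.mem_univ, true_and] at hk
          omega
      rw [h5, h.firstChild_card]
      exact hi
    · omega

lemma exists_parent (τ : Fin n → ℕ) {m v : ℕ} (hv : 0 < v) (hvm : v < firstChild τ m)
    (hm : m ≤ n) : ∃ i : Fin n, i.val < m ∧ firstChild τ i.val ≤ v ∧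
      v < firstChild τ (i.val + 1) := by
  induction m with
  | zero => rw [firstChild_zero] at hvm; omega
  | succ m ih =>
    by_cases h : v < firstChild τ m
    · obtain ⟨i, h1, h2⟩ := ih h (by omega)
      exact ⟨i, by omega, h2⟩
    · exact ⟨⟨m, by omega⟩, by simp, not_lt.1 h, hvm⟩

lemma IsBalanced.greedyTree_adj (h : IsBalanced τ) {i j : Fin n} :
    (greedyTree τ).Adj i j ↔ (firstChild τ i.val ≤ j.val ∧ j.val < firstChild τ (i.val + 1)) ∨
      (firstChild τ j.val ≤ i.val ∧ i.val < firstChild τ (j.val + 1)) := by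
  unfold greedyTree
  rw [fromRel_adj]
  refine and_iff_right_of_imp ?_
  rintro h1 rfl
  have := h.lt_firstChild i.isLt
  omega

/-- The vertices with labels below `m` have the same neighbours in `G` as in the greedy tree. -/
def Agrees {n : ℕ} (τ : Fin n → ℕ) (m : ℕ) (G : SimpleGraph (Fin n)) : Prop :=
  ∀ i j : Fin n, i.val < m → (G.Adj i j ↔ (greedyTree τ).Adj i j)

namespace Agrees

variable {G : SimpleGraph (Fin n)} {m : ℕ} {r : Fin n}

/-- The direction toward the root is the parent in the greedy tree. -/
lemma toward_root (hA : Agrees τ m G) (h : IsBalanced τ) (hG : G.IsTree) (hm : m ≤ n)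
    (hr : r.val = 0) {v : Fin n} (hv : 0 < v.val) (hvm : v.val < firstChild τ m) :
    (toward G r v).val < m ∧ firstChild τ (toward G r v).val ≤ v.val ∧
      v.val < firstChild τ ((toward G r v).val + 1) := by
  induction hk : v.val using Nat.strong_induction_on generalizing v with
  | _ k ih =>
    obtain ⟨i, h1, h2, h3⟩ := exists_parent τ hv hvm hm
    have h4 : G.Adj i v := (hA i v h1).2 (h.greedyTree_adj.2 (Or.inl ⟨h2, h3⟩))
    rcases adj_toward hG r h4.symm with ⟨h5, -⟩ | ⟨h5, h6⟩
    · rw [← h5, ← hk]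
      exact ⟨h1, h2, h3⟩
    · have h7 : i ≠ r := by rintro rfl; simp at h6
      have h8 : 0 < i.val := by
        by_contra h8
        exact h7 (Fin.ext (by omega))
      have h9 := h.lt_firstChild i.isLt
      have h10 := ih i.val (by omega) h8 (by omega) rfl
      rw [← h5] at h10
      have h11 := h.lt_firstChild v.isLt
      omega

lemma toward_root_lt (hA : Agrees τ m G) (h : IsBalanced τ) (hG : G.IsTree) (hm : m ≤ n)
    (hr : r.val = 0) {v : Fin n} (hv : 0 < v.val) (hvm : v.val < firstChild τ m) :
    (toward G r v).val < v.val := by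
  have h1 := hA.toward_root h hG hm hr hv hvm
  have h2 := h.lt_firstChild (toward G r v).isLt
  omega

lemma placed_of_adj (hA : Agrees τ m G) (h : IsBalanced τ) {i j : Fin n}
    (hi : i.val < m) (hij : G.Adj i j) : j.val < firstChild τ m := by
  have h0 : firstChild τ (i.val + 1) ≤ firstChild τ m := firstChild_mono τ hi
  have h3 := h.lt_firstChild i.isLt
  have h4 := firstChild_mono τ i.val.le_succ
  rcases h.greedyTree_adj.1 ((hA i j hi).1 hij) with ⟨h1, h2⟩ | ⟨h1, h2⟩
  · omega
  · have h5 := h.lt_firstChild j.isLt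
    simp only [Nat.succ_eq_add_one] at h4
    omega

/-- The order of the labels is respected by the step toward the root. -/
lemma toward_root_mono (hA : Agrees τ m G) (h : IsBalanced τ) (hG : G.IsTree) (hm : m ≤ n)
    (hr : r.val = 0) {u v : Fin n} (hu : 0 < u.val) (hum : u.val < firstChild τ m)
    (huv : u.val < v.val) : (toward G r u).val ≤ (toward G r v).val := by
  by_contra hlt
  have h1 := hA.toward_root h hG hm hr hu hum
  have h2 := hA.toward_root_lt h hG hm hr hu hum
  have hvr : v ≠ r := by rintro rfl; omega
  have h3 := (toward_spec hG.connected hvr).1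
  rcases h.greedyTree_adj.1 ((hA _ _ (by omega)).1 h3.symm) with ⟨h4, h5⟩ | ⟨h4, h5⟩
  · have : firstChild τ ((toward G r v).val + 1) ≤ firstChild τ (toward G r u).val :=
      firstChild_mono τ (by omega)
    omega
  · have := h.lt_firstChild v.isLt
    omega

lemma dist_root_mono (hA : Agrees τ m G) (h : IsBalanced τ) (hG : G.IsTree) (hm : m ≤ n)
    (hr : r.val = 0) {u v : Fin n} (hum : u.val < firstChild τ m) (huv : u.val ≤ v.val) :
    G.dist r u ≤ G.dist r v := by
  induction hk : u.val using Nat.strong_induction_on generalizing u v with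
  | _ k ih =>
    by_cases hu : u.val = 0
    · have : u = r := Fin.ext (by omega)
      rw [this, SimpleGraph.dist_self]
      exact Nat.zero_le _
    by_cases huv' : u.val = v.val
    · rw [Fin.ext huv']
    have h1 := hA.toward_root_mono h hG hm hr (u := u) (v := v) (by omega) hum (by omega)
    have h2 := hA.toward_root_lt h hG hm hr (v := u) (by omega) hum
    have h3 := ih _ (by omega) (by omega) h1 rfl
    have h4 := (toward_spec hG.connected (show u ≠ r by rintro rfl; omega)).2
    have h5 := (toward_spec hG.connected (show v ≠ r by rintro rfl; omega)).2
    omega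

variable {a b : Fin n} {σ : Fin n → Fin n}

/-- If the root is equidistant from `a` and `b`, the half of the geodesic from `a` to the middle
runs to the left of its reflection. -/
lemma lt_map_of_onGeodesic (hA : Agrees τ m G) (h : IsBalanced τ) (hG : G.IsTree) (hm : m ≤ n)
    (hr : r.val = 0) (ha : a.val < firstChild τ m) (hab : a.val < b.val)
    (hσ : IsReflection G a b σ) (h1 : ¬ Near G a b r) (h2 : ¬ Near G b a r) {p : Fin n}
    (hp : OnGeodesic G a b p) (hpn : Near G a b p) :
    p.val < firstChild τ m ∧ p.val < (σ p).val := by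
  induction hk : G.dist a p generalizing p with
  | zero =>
    rw [hG.connected.dist_eq_zero_iff] at hk
    rw [← hk, hσ.map_end]
    exact ⟨ha, hab⟩
  | succ k ih =>
    have hpa : p ≠ a := by rintro rfl; simp at hk
    obtain ⟨h3, h4⟩ := toward_spec hG.connected hpa
    obtain ⟨h5, h6⟩ := hp.toward_left hG.connected hpa
    have h7 : Near G a b (toward G a p) := by unfold Near at *; omega
    have h8 : p = toward G b (toward G a p) := eq_toward hG h3.symm (by omega)
    obtain ⟨h9, h10⟩ := ih h5 h7 (by omega)
    have h11 := hσ.geod_left h5 h7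
    have h12 : σ p = toward G r (σ (toward G a p)) := by
      rw [(hσ.swap_left h7 h11).toward_eq hG h2, ← hσ.parent_left h7 h11, ← h8]
    have h13 : p = toward G r (toward G a p) := by rw [h7.toward_eq hG h1, ← h8]
    have h14 : 0 < (toward G a p).val := by
      by_contra h14
      exact h1 ((Fin.ext (by omega) : toward G a p = r) ▸ h7)
    have h15 := hA.toward_root_mono h hG hm hr h14 h9 h10
    have h16 := hA.toward_root_lt h hG hm hr h14 h9
    rw [← h12, ← h13] at h15
    rw [← h13] at h16
    have h17 := hσ.geod_left hp hpn
    refine ⟨by omega, lt_of_le_of_ne h15 fun h18 => h17 (Fin.ext h18.symm)⟩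

/-- A vertex of the `b`-side that is already placed is matched with a vertex of smaller label. -/
lemma map_lt (hA : Agrees τ m G) (h : IsBalanced τ) (hG : G.IsTree) (hm : m ≤ n)
    (hr : r.val = 0) (ha : a.val < firstChild τ m) (hab : a.val < b.val)
    (hσ : IsReflection G a b σ) {q : Fin n} (hq : Near G b a q) (hqm : σ q ≠ q)
    (hqp : q.val < firstChild τ m) : (σ q).val < q.val := by
  have hrb : ¬ Near G b a r := by
    have := hA.dist_root_mono h hG hm hr ha hab.le
    unfold Near
    rw [SimpleGraph.dist_comm, SimpleGraph.dist_comm (u := a)]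
    omega
  have hs := hσ.symm hG
  induction hk : q.val using Nat.strong_induction_on generalizing q with
  | _ k ih =>
    have hq0 : 0 < q.val := by
      by_contra h0
      exact hrb ((Fin.ext (by omega) : q = r) ▸ hq)
    have htq : toward G r q = toward G a q := hq.toward_eq hG hrb
    have h1 := hA.toward_root h hG hm hr hq0 hqp
    have h2 := hA.toward_root_lt h hG hm hr hq0 hqp
    rw [htq] at h1 h2
    have hp := hσ.swap_right hq hqm
    have hpm := hσ.ne_iff.2 hqm
    have hpar : σ (toward G a q) = toward G b (σ q) := hs.parent_left hq hqm
    have hadj := (toward_spec hG.connected hp.ne_right).1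
    by_cases h3 : Near G b a (toward G a q)
    · have h4 := hs.closed_left hq hqm (Or.inl h3)
      have h5 := ih _ (by omega) h3 h4 (by omega) rfl
      rw [hpar] at h5
      rcases h.greedyTree_adj.1 ((hA _ _ (by omega)).1 hadj.symm) with ⟨h6, h7⟩ | ⟨h6, h7⟩
      · have : firstChild τ ((toward G b (σ q)).val + 1) ≤ firstChild τ (toward G a q).val :=
          firstChild_mono τ h5
        omega
      · have := h.lt_firstChild (σ q).isLt
        omega
    by_cases h4 : Near G a b (toward G a q)
    · rw [hs.mid_left hq h4]
      omega
    · rw [hσ.eq_of_not_near h4 h3] at hpar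
      have hcross : ¬ Near G a b (toward G b (σ q)) := by rwa [← hpar]
      rcases adj_toward hG r hadj with ⟨h5, h6⟩ | ⟨h5, h6⟩
      · have h7 := hp.not_near_of_crossing hG (r := r) hcross hcross (by omega)
        have h8 := hA.lt_map_of_onGeodesic h hG hm hr ha hab hσ h7 hrb
          (hp.crossing hG hcross).1 hp
        rw [hσ.invol] at h8
        omega
      · rw [← hpar] at h5 h6
        have h7 : 0 < (toward G a q).val := by
          by_contra h7
          rw [(Fin.ext (by omega) : toward G a q = r), SimpleGraph.dist_self] at h6
          omega
        have h8 := hA.toward_root_lt h hG hm hr h7 (by omega)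
        rw [← h5] at h8
        omega

end Agrees

/-- A polarization that moves branches only onto vertices whose reflection has larger degree (with
the possible exception of `a`) does not disturb the vertices that are already in greedy position. -/
lemma Agrees.polarize {G : SimpleGraph (Fin n)} {a b : Fin n} {σ : Fin n → Fin n}
    (hA : Agrees τ a.val G) (h : IsBalanced τ) (hG : G.IsTree)
    (hd : ∀ i : Fin n, i.val < a.val → deg G i = τ i) (hle : ∀ i, a.val ≤ i.val → deg G i ≤ τ a)
    (hab : a.val < b.val) (hσ : IsReflection G a b σ)
    (hmv : ∀ p c, p ≠ a → Near G a b p → σ p ≠ p → Unmatched G b a σ c → G.Adj (σ p) c →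
      deg G p < deg G (σ p)) {i : Fin n} (hi : i.val < a.val) (j : Fin n) :
    (polarize G a b σ).Adj i j ↔ G.Adj i j := by
  obtain ⟨r, hr⟩ : ∃ r : Fin n, r.val = 0 := ⟨⟨0, by have := a.isLt; omega⟩, rfl⟩
  have ha := h.lt_firstChild a.isLt
  have hm := a.isLt.le
  have hrb : ¬ Near G b a r := by
    have := hA.dist_root_mono h hG hm hr ha hab.le
    unfold Near
    rw [SimpleGraph.dist_comm, SimpleGraph.dist_comm (u := a)]
    omega
  refine hσ.polarize_adj_iff hG (S := fun v => v.val < a.val) ?_ hi j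
  intro p c hp hpm hc hadj
  have hlt : (σ p).val < firstChild τ a.val → p.val < (σ p).val := by
    intro h1
    have := hA.map_lt h hG hm hr ha hab hσ (hσ.swap_left hp hpm) (hσ.ne_iff.2 hpm) h1
    rwa [hσ.invol] at this
  have h1 : ¬ p.val < a.val := by
    intro h1
    have h2 := hmv p c (by rintro rfl; omega) hp hpm hc hadj
    rw [hd p h1] at h2
    by_cases h3 : (σ p).val < a.val
    · rw [hd _ h3] at h2
      have := h.anti (show p ≤ σ p from (hlt (by omega)).le)
      omega
    · have h4 := hle (σ p) (by omega)
      have := h.anti (show p ≤ a from h1.le)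
      omega
  have h2 : ¬ (σ p).val < a.val := fun h2 => h1 ((hlt (by omega)).trans h2)
  refine ⟨h1, h2, fun h3 => h2 ?_⟩
  have h4 := ((hσ.symm hG).nbr_of_unmatched hG hc hadj.symm
    (IsReflection.not_unmatched_of_ne (hσ.ne_iff.2 hpm))).2.2
  have h5 : 0 < c.val := by
    by_contra h5
    exact hrb ((Fin.ext (by omega) : c = r) ▸ hc.1)
  have h6 := hA.toward_root_lt h hG hm hr h5 (by omega)
  rw [hc.1.toward_eq hG hrb, ← h4] at h6
  omega

end

section

variable {n : ℕ} {τ : Fin n → ℕ} {G : SimpleGraph (Fin n)}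

/-! ### Transforming a tree into the greedy tree -/

/-- An intermediate stage between an arbitrary tree and the greedy tree of `τ`: the vertices below
`m` are already in their greedy position, and the degree sequence is majorized by `τ`. Majorization
is expressed by the sums of the truncated excesses over all thresholds `t`, so that the degrees need
not be sorted. -/
structure IsStage (τ : Fin n → ℕ) (m : ℕ) (G : SimpleGraph (Fin n)) : Prop where
  isTree : G.IsTree
  agrees : Agrees τ m G
  deg_eq : ∀ i : Fin n, i.val < m → deg G i = τ i
  excess_le : ∀ t : ℕ, ∑ v, (deg G v - t) ≤ ∑ i, (τ i - t)

lemma IsStage.deg_le (hS : IsStage τ m G) (h : IsBalanced τ) {a v : Fin n} (ha : a.val = m)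
    (hv : a.val ≤ v.val) : deg G v ≤ τ a := by
  by_contra hlt
  refine absurd (hS.excess_le (τ a)) (not_le.2 (Finset.sum_lt_sum (fun i _ => ?_)
    ⟨v, Finset.mem_univ _, ?_⟩))
  · by_cases hi : i.val < m
    · rw [hS.deg_eq i hi]
    · have := h.anti (show a ≤ i from Fin.le_def.2 (by omega))
      omega
  · have := h.anti (show a ≤ v from hv)
    omega

lemma deg_comap {V : Type*} [Fintype V] (G : SimpleGraph V) (f : Equiv.Perm V) (v : V) :
    deg (G.comap f) v = deg G (f v) := by
  classical
  unfold deg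
  refine Finset.card_nbij' f f.symm ?_ ?_ (fun w _ => f.symm_apply_apply w)
    (fun w _ => f.apply_symm_apply w)
  · intro w hw
    simpa using hw
  · intro w hw
    simpa using hw

/-- A permutation of the labels from `L` on that brings a set `N` of such labels to the front. -/
lemma exists_perm_front (L k : ℕ) (N : Finset (Fin n)) (hN : ∀ x ∈ N, L ≤ x.val)
    (hk : N.card = k) (hL : L ≤ n) : ∃ f : Equiv.Perm (Fin n), (∀ x : Fin n, x.val < L → f x = x) ∧
      ∀ x : Fin n, L ≤ x.val → L ≤ (f x).val ∧ (f x ∈ N ↔ x.val < L + k) := by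
  classical
  have hcount : ∀ j, L + j ≤ n →
      (Finset.univ.filter fun x : Fin n => L ≤ x.val ∧ x.val < L + j).card = j := by
    intro j hj
    rw [← Finset.card_map Fin.valEmbedding]
    have : (Finset.univ.filter fun x : Fin n => L ≤ x.val ∧ x.val < L + j).map Fin.valEmbedding =
        Finset.Ico L (L + j) := by
      ext x
      simp only [Finset.mem_map, Finset.mem_filter, Finset.mem_univ, true_and,
        Fin.valEmbedding_apply, Finset.mem_Ico]
      constructor
      · rintro ⟨y, hy, rfl⟩
        exact hy
      · intro hx
        exact ⟨⟨x, by omega⟩, hx, rfl⟩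
    rw [this, Nat.card_Ico]
    omega
  have hkn : L + k ≤ n := by
    have h1 : N ⊆ Finset.univ.filter fun x : Fin n => L ≤ x.val ∧ x.val < L + (n - L) := by
      intro x hx
      have := hN x hx
      have := x.isLt
      simp only [Finset.mem_filter, Finset.mem_univ, true_and]
      omega
    have h2 := Finset.card_le_card h1
    rw [hcount _ (by omega)] at h2
    omega
  have hcard : Fintype.card {y : {x : Fin n // L ≤ x.val} // y.1.val < L + k} =
      Fintype.card {y : {x : Fin n // L ≤ x.val} // y.1 ∈ N} := by
    rw [Fintype.card_congr (Equiv.subtypeSubtypeEquivSubtypeInter (fun x : Fin n => L ≤ x.val)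
        fun x => x.val < L + k),
      Fintype.card_congr (Equiv.subtypeSubtypeEquivSubtypeInter (fun x : Fin n => L ≤ x.val)
        fun x => x ∈ N), Fintype.card_subtype, Fintype.card_subtype, hcount k hkn, ← hk]
    congr 1
    ext x
    simp only [Finset.mem_filter, Finset.mem_univ, true_and]
    exact ⟨fun hx => ⟨hN x hx, hx⟩, fun hx => hx.2⟩
  obtain ⟨g, hg⟩ : ∃ g : Equiv.Perm {x : Fin n // L ≤ x.val},
      ∀ y, (g y).1 ∈ N ↔ y.1.val < L + k := by
    refine ⟨(Fintype.equivOfCardEq hcard).extendSubtype, fun y => ⟨fun h1 => ?_, fun h1 => ?_⟩⟩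
    · by_contra h2
      exact Equiv.extendSubtype_not_mem (Fintype.equivOfCardEq hcard) y h2 h1
    · exact Equiv.extendSubtype_mem (Fintype.equivOfCardEq hcard) y h1
  refine ⟨Equiv.Perm.ofSubtype g, fun x hx => ?_, fun x hx => ?_⟩
  · exact Equiv.Perm.ofSubtype_apply_of_not_mem g (not_le.2 hx)
  · rw [Equiv.Perm.ofSubtype_apply_of_mem g hx]
    exact ⟨(g ⟨x, hx⟩).2, hg ⟨x, hx⟩⟩

/-- Once the vertex `a` has the right degree, relabelling puts its children into position. -/
lemma IsStage.relabel {a : Fin n} (hS : IsStage τ a.val G) (h : IsBalanced τ)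
    (hd : deg G a = τ a) :
    ∃ G', PairsCloser G G' ∧ IsStage τ (a.val + 1) G' := by
  classical
  have hG := hS.isTree
  have hA := hS.agrees
  obtain ⟨r, hr⟩ : ∃ r : Fin n, r.val = 0 := ⟨⟨0, by have := a.isLt; omega⟩, rfl⟩
  have ha := h.lt_firstChild a.isLt
  have hm := a.isLt.le
  obtain ⟨L, hL⟩ : ∃ L, L = firstChild τ a.val := ⟨_, rfl⟩
  have hLn : L ≤ n := by
    rw [hL]
    exact (firstChild_mono τ hm).trans_eq h.firstChild_card
  -- The only placed neighbour of `a` is its parent.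
  have hnbr : ∀ w, G.Adj a w → w.val < L → 0 < a.val ∧ w = toward G r a := by
    intro w hw hwL
    rcases adj_toward hG r hw with ⟨h1, h2⟩ | ⟨h1, h2⟩
    · refine ⟨?_, h1⟩
      by_contra h3
      rw [(Fin.ext (by omega) : a = r), SimpleGraph.dist_self] at h2
      omega
    · have h3 : 0 < w.val := by
        by_contra h3
        rw [(Fin.ext (by omega) : w = r), SimpleGraph.dist_self] at h2
        omega
      have h4 := hA.toward_root h hG hm hr h3 (hL ▸ hwL)
      rw [← h1] at h4
      omega
  obtain ⟨N, hN⟩ : ∃ N : Finset (Fin n), N = Finset.univ.filter fun w => G.Adj a w ∧ L ≤ w.val :=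
    ⟨_, rfl⟩
  have hmemN : ∀ w, w ∈ N ↔ G.Adj a w ∧ L ≤ w.val := by simp [hN]
  have hcard : N.card = numChildren τ a := by
    by_cases h0 : a.val = 0
    · rw [numChildren, if_pos h0, ← hd, deg]
      congr 1
      ext w
      simp only [hmemN, Finset.mem_filter, Finset.mem_univ, true_and, and_iff_left_iff_imp]
      intro hw
      by_contra h1
      have := hnbr w hw (not_le.1 h1)
      omega
    · have hpar := toward_spec hG.connected (show a ≠ r by rintro rfl; omega)
      have hlt := hA.toward_root h hG hm hr (v := a) (by omega) ha
      rw [numChildren, if_neg h0, ← hd, deg]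
      have : N = (Finset.univ.filter (G.Adj a)).erase (toward G r a) := by
        ext w
        simp only [hmemN, Finset.mem_filter, Finset.mem_univ, true_and, Finset.mem_erase]
        constructor
        · rintro ⟨h1, h2⟩
          refine ⟨?_, h1⟩
          rintro rfl
          omega
        · rintro ⟨h1, h2⟩
          refine ⟨h2, ?_⟩
          by_contra h3
          exact h1 (hnbr w h2 (not_le.1 h3)).2
      rw [this, Finset.card_erase_of_mem (by simp [hpar.1])]
  obtain ⟨f, hf1, hf2⟩ := exists_perm_front L (numChildren τ a) N (fun x hx => ((hmemN x).1 hx).2)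
    hcard hLn
  have hself : ∀ m, Agrees τ m (greedyTree τ) := fun _ _ _ _ => Iff.rfl
  have hiso : G.comap f ≃g G := Iso.comap f G
  refine ⟨G.comap f, pairsCloser_of_iso hG.connected hiso.symm, ?_, ?_, ?_, ?_⟩
  · exact hiso.isTree_iff.2 hG
  · intro i j hi
    have hfi : f i = i := hf1 i (by omega)
    rw [comap_adj, hfi]
    by_cases hia : i.val < a.val
    · by_cases hj : j.val < L
      · rw [hf1 j hj]
        exact hA i j hia
      · have h1 := hf2 j (not_lt.1 hj)
        refine iff_of_false (fun h2 => ?_) fun h2 => ?_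
        · have := hA.placed_of_adj h hia h2
          omega
        · have := (hself a.val).placed_of_adj h hia h2
          omega
    · obtain rfl : i = a := Fin.ext (by omega)
      have hfc := firstChild_succ τ i
      have hjlt := h.lt_firstChild j.isLt
      by_cases hj : j.val < L
      · rw [hf1 j hj]
        by_cases hji : j.val < i.val
        · rw [G.adj_comm, (greedyTree τ).adj_comm]
          exact hA j i hji
        · refine iff_of_false (fun h2 => ?_) fun h2 => ?_
          · obtain ⟨h3, h4⟩ := hnbr j h2 hj
            have := hA.toward_root_lt h hG hm hr h3 ha
            rw [← h4] at this
            omega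
          · rcases h.greedyTree_adj.1 h2 with h3 | h3 <;> omega
      · obtain ⟨h1, h2⟩ := hf2 j (not_lt.1 hj)
        rw [h.greedyTree_adj, ← hL, hfc, ← hL, ← h2, hmemN]
        have : ¬ (firstChild τ j.val ≤ i.val ∧ i.val < firstChild τ (j.val + 1)) := by omega
        simp only [this, or_false]
        have h3 : L ≤ j.val := not_lt.1 hj
        simp only [h1, h3, and_true, true_and]
  · intro i hi
    rw [deg_comap, hf1 i (by omega)]
    by_cases hia : i.val < a.val
    · exact hS.deg_eq i hia
    · obtain rfl : i = a := Fin.ext (by omega)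
      exact hd
  · intro t
    simp only [deg_comap]
    rw [Equiv.sum_comp f fun v => deg G v - t]
    exact hS.excess_le t

lemma sum_excess_succ {ι : Type*} [Fintype ι] (f : ι → ℕ) (t : ℕ) :
    ∑ i, (f i - t) = ∑ i, (f i - (t + 1)) + (Finset.univ.filter fun i => t < f i).card := by
  rw [Finset.card_filter, ← Finset.sum_add_distrib]
  refine Finset.sum_congr rfl fun i _ => ?_
  split_ifs <;> omega

/-- A polarization that raises the degree of `a` leads to another stage. -/
lemma IsStage.of_polarize {a b : Fin n} {σ : Fin n → Fin n} (hS : IsStage τ a.val G)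
    (h : IsBalanced τ) (hab : a.val < b.val) (hσ : IsReflection G a b σ)
    (hexc : ∀ t : ℕ, ∑ v, (deg (polarize G a b σ) v - t) ≤ ∑ i, (τ i - t))
    (hmv : ∀ p c, p ≠ a → Near G a b p → σ p ≠ p → Unmatched G b a σ c → G.Adj (σ p) c →
      deg G p < deg G (σ p)) : IsStage τ a.val (polarize G a b σ) := by
  have hG := hS.isTree
  have hadj : ∀ i : Fin n, i.val < a.val → ∀ j, (polarize G a b σ).Adj i j ↔ G.Adj i j :=
    fun i hi j => hS.agrees.polarize h hG hS.deg_eq (fun i hi => hS.deg_le h rfl hi) hab hσ hmv hi j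
  refine ⟨hσ.polarize_isTree hG, fun i j hi => (hadj i hi j).trans (hS.agrees i j hi), ?_, hexc⟩
  intro i hi
  rw [← hS.deg_eq i hi]
  unfold deg
  congr 1
  ext j
  simp [hadj i hi j]

/-- If `a` has too small a degree, some polarization raises it. -/
lemma IsStage.raise {a : Fin n} (hS : IsStage τ a.val G) (h : IsBalanced τ)
    (hd : deg G a ≠ τ a) :
    ∃ G', PairsCloser G G' ∧ IsStage τ a.val G' ∧ deg G a < deg G' a := by
  classical
  have hG := hS.isTree
  have hlt : deg G a < τ a := lt_of_le_of_ne (hS.deg_le h rfl le_rfl) hd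
  by_cases hcase : ∃ b : Fin n, a.val < b.val ∧ deg G a < deg G b
  · obtain ⟨b, hab, hb⟩ := hcase
    obtain ⟨σ, hσ, h1, h2, h3⟩ := exists_reflection_swap hG hb
    exact ⟨_, hσ.pairsCloser hG, hS.of_polarize h hab hσ
      (fun t => (h2 (· - t)).trans (hS.excess_le t)) (fun p c _ => h3 p c), h1⟩
  -- All remaining degrees are at most that of `a`, so a branch has to be moved to `a` from a
  -- vertex `b` for which this does not violate the majorization.
  have hle : ∀ b : Fin n, a.val ≤ b.val → deg G b ≤ deg G a := by
    intro b hab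
    by_contra hlt
    refine hcase ⟨b, lt_of_le_of_ne hab fun h1 => ?_, not_le.1 hlt⟩
    rw [Fin.ext h1] at hlt
    exact hlt le_rfl
  have hpos : ∀ v, 1 ≤ deg G v := by
    have hn2 : 2 ≤ n := by
      have h1 := h.sum
      have h2 := h.pos a
      have h3 := Finset.single_le_sum (f := τ) (fun i _ => Nat.zero_le _) (Finset.mem_univ a)
      omega
    intro v
    have : Nontrivial (Fin n) := Fin.nontrivial_iff_two_le.2 hn2
    obtain ⟨u, hu⟩ := exists_ne v
    exact Finset.card_pos.2 ⟨toward G u v, by simp [(toward_spec hG.connected hu.symm).1]⟩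
  have hstrict : ∑ v, (deg G v - deg G a) < ∑ i, (τ i - deg G a) := by
    refine Finset.sum_lt_sum (fun i _ => ?_) ⟨a, Finset.mem_univ _, by omega⟩
    by_cases hi : i.val < a.val
    · rw [hS.deg_eq i hi]
    · have := hle i (by omega)
      omega
  have hone : ∑ v, (deg G v - 1) = ∑ i, (τ i - 1) := by
    have h1 := (isTree_iff_sum_deg.1 hG).2
    have h2 := h.sum
    rw [Fintype.card_fin] at h1
    have h3 : ∀ f : Fin n → ℕ, (∀ i, 1 ≤ f i) → ∑ i, (f i - 1) + n = ∑ i, f i := by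
      intro f hf
      have : ∑ i : Fin n, f i = ∑ i, ((f i - 1) + 1) :=
        Finset.sum_congr rfl fun i _ => by have := hf i; omega
      rw [this, Finset.sum_add_distrib]
      simp
    have h4 := h3 _ hpos
    have h5 := h3 _ h.pos
    omega
  -- `c` is the largest threshold below the degree of `a` at which the majorization is tight.
  obtain ⟨c, hc1, hce, htight, hmax⟩ : ∃ c, 1 ≤ c ∧ c ≤ deg G a ∧
      ∑ v, (deg G v - c) = ∑ i, (τ i - c) ∧
      ∀ t, c < t → t ≤ deg G a → ∑ v, (deg G v - t) < ∑ i, (τ i - t) := by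
    let P : ℕ → Prop := fun t => 1 ≤ t ∧ ∑ v, (deg G v - t) = ∑ i, (τ i - t)
    have hP : P (Nat.findGreatest P (deg G a)) :=
      Nat.findGreatest_spec (hpos a) (show P 1 from ⟨le_rfl, hone⟩)
    refine ⟨Nat.findGreatest P (deg G a), hP.1, Nat.findGreatest_le _, hP.2, fun t h1 h2 => ?_⟩
    refine lt_of_le_of_ne (hS.excess_le t) fun h3 => ?_
    exact Nat.findGreatest_is_greatest h1 h2 ⟨by omega, h3⟩
  have hce' : c < deg G a := by
    refine lt_of_le_of_ne hce ?_
    rintro rfl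
    omega
  have hex : ((Finset.univ.filter fun v : Fin n => a.val < v.val ∧ c < deg G v)).Nonempty := by
    by_contra hemp
    rw [Finset.not_nonempty_iff_eq_empty, Finset.filter_eq_empty_iff] at hemp
    have h1 := sum_excess_succ (deg G) c
    have h2 := sum_excess_succ τ c
    have h3 := hmax (c + 1) (by omega) (by omega)
    have h4 : (Finset.univ.filter fun v => c < deg G v) ⊆
        Finset.univ.filter fun i => c < τ i := by
      intro v hv
      simp only [Finset.mem_filter, Finset.mem_univ, true_and] at hv ⊢
      have h5 : v.val ≤ a.val := by
        by_contra h5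
        exact hemp (Finset.mem_univ v) ⟨not_le.1 h5, hv⟩
      have := h.anti (show v ≤ a from h5)
      omega
    have := Finset.card_le_card h4
    omega
  obtain ⟨b, hb, hmin⟩ := Finset.exists_min_image _ (deg G) hex
  simp only [Finset.mem_filter, Finset.mem_univ, true_and] at hb
  obtain ⟨σ, hσ, h1, h2, h3⟩ := exists_reflection_shift hG (a := a) (b := b)
    (by rintro rfl; omega) (hle b hb.1.le) (by omega)
  refine ⟨_, hσ.pairsCloser hG, hS.of_polarize h hb.1 hσ (fun t => (h2 t).trans ?_) h3, h1⟩
  split_ifs with ht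
  · have := hmax t (by omega) ht.2
    omega
  · exact hS.excess_le t

lemma IsStage.complete (h : IsBalanced τ) : ∀ (k m : ℕ) (G : SimpleGraph (Fin n)),
    IsStage τ m G → m + k = n → ∃ G', PairsCloser G G' ∧ IsStage τ n G' := by
  intro k
  induction k with
  | zero =>
    intro m G hS hm
    obtain rfl : m = n := by omega
    exact ⟨G, PairsCloser.refl G, hS⟩
  | succ k ih =>
    intro m G hS hm
    obtain ⟨a, rfl⟩ : ∃ a : Fin n, a.val = m := ⟨⟨m, by omega⟩, rfl⟩
    induction hj : τ a - deg G a using Nat.strong_induction_on generalizing G with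
    | _ j ihj =>
      by_cases hd : deg G a = τ a
      · obtain ⟨G₁, h1, h2⟩ := hS.relabel h hd
        obtain ⟨G₂, h3, h4⟩ := ih _ G₁ h2 (by omega)
        exact ⟨G₂, h1.trans h3, h4⟩
      · obtain ⟨G₁, h1, h2, h3⟩ := hS.raise h hd
        have h4 := h2.deg_le h rfl le_rfl
        obtain ⟨G₂, h5, h6⟩ := ihj _ (by omega) G₁ h2 rfl
        exact ⟨G₂, h1.trans h5, h6⟩

/-- Every tree whose degrees are majorized by `τ` has its vertices at least as far apart as the
greedy tree of `τ`, in the sense of a distance nonincreasing bijection of pairs; moreover the greedy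
tree is a tree with degrees `τ`. -/
theorem pairsCloser_greedyTree (h : IsBalanced τ) (hG : G.IsTree)
    (hle : ∀ t : ℕ, ∑ v, (deg G v - t) ≤ ∑ i, (τ i - t)) :
    PairsCloser G (greedyTree τ) ∧ (greedyTree τ).IsTree ∧ ∀ i, deg (greedyTree τ) i = τ i := by
  obtain ⟨G', h1, h2⟩ := IsStage.complete h n 0 G
    ⟨hG, fun _ _ hi => absurd hi (Nat.not_lt_zero _), fun _ hi => absurd hi (Nat.not_lt_zero _),
      hle⟩ (by omega)
  obtain rfl : G' = greedyTree τ := by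
    ext i j
    exact h2.agrees i j i.isLt
  exact ⟨h1, h2.isTree, fun i => h2.deg_eq i i.isLt⟩

end

/-! ### Majorization -/

/-- A downward closed set of indices is an initial segment. -/
lemma exists_initial {n : ℕ} {P : Fin n → Prop} (hP : ∀ i j : Fin n, i ≤ j → P j → P i) :
    ∃ k : ℕ, ∀ i : Fin n, P i ↔ i.val < k := by
  classical
  by_cases h : ∃ k : ℕ, ∃ hk : k < n, ¬ P ⟨k, hk⟩
  · refine ⟨Nat.find h, fun i => ⟨fun hi => ?_, fun hi => ?_⟩⟩
    · obtain ⟨h1, h2⟩ := Nat.find_spec h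
      by_contra h3
      exact h2 (hP _ i (Fin.le_def.2 (not_lt.1 h3)) hi)
    · by_contra h1
      exact Nat.find_min h hi ⟨i.isLt, h1⟩
  · simp only [not_exists, not_not] at h
    exact ⟨n, fun i => ⟨fun _ => i.isLt, fun _ => h i.val i.isLt⟩⟩

variable {n : ℕ} {x y : Fin n → ℕ}

/-- The partial sums over the superlevel sets of the nonincreasing sequence `x` are monotone. -/
lemma MajorizedBy.sum_superlevel_le (h : MajorizedBy x y) (hx : Antitone x) (t : ℕ) :
    ∑ i with t < x i, x i ≤ ∑ i with t < x i, y i := by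
  obtain ⟨k, hk⟩ := exists_initial (P := fun i => t < x i)
    fun i j hij hj => lt_of_lt_of_le hj (hx hij)
  simp only [hk]
  exact h.1 k

lemma MajorizedBy.excess_le (h : MajorizedBy x y) (hx : Antitone x) (t : ℕ) :
    ∑ i, (x i - t) ≤ ∑ i, (y i - t) := by
  have h1 := h.sum_superlevel_le hx t
  have h2 : ∑ i, (x i - t) = ∑ i with t < x i, (x i - t) := by
    rw [Finset.sum_filter]
    refine Finset.sum_congr rfl fun i _ => ?_
    split_ifs <;> omega
  have h3 : ∑ i with t < x i, x i = ∑ i with t < x i, (x i - t) + ∑ i with t < x i, t := by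
    rw [← Finset.sum_add_distrib]
    refine Finset.sum_congr rfl fun i hi => ?_
    simp only [Finset.mem_filter, Finset.mem_univ, true_and] at hi
    omega
  have h4 : ∑ i with t < x i, y i ≤ ∑ i with t < x i, (y i - t) + ∑ i with t < x i, t := by
    rw [← Finset.sum_add_distrib]
    exact Finset.sum_le_sum fun i _ => by omega
  have h5 : ∑ i with t < x i, (y i - t) ≤ ∑ i, (y i - t) :=
    Finset.sum_le_sum_of_subset (Finset.filter_subset _ _)
  omega

/-- Strict majorization increases the sum of squares: by a layer-cake decomposition of the factor
`x`, one has `∑ x² ≤ ∑ x y`, and then `∑ (y - x)² > 0` gives the claim. -/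
lemma MajorizedBy.sum_sq_lt (h : MajorizedBy x y) (hx : Antitone x) (hne : x ≠ y) :
    ∑ i, x i * x i < ∑ i, y i * y i := by
  have hlayer : ∀ z : Fin n → ℕ, ∑ i, x i * z i =
      ∑ t ∈ Finset.range (∑ i, x i), ∑ i with t < x i, z i := by
    intro z
    simp only [Finset.sum_filter]
    rw [Finset.sum_comm]
    refine Finset.sum_congr rfl fun i _ => ?_
    rw [← Finset.sum_filter, Finset.sum_const, smul_eq_mul]
    congr 1
    have : (Finset.range (∑ i, x i)).filter (fun t => t < x i) = Finset.range (x i) := by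
      have := Finset.single_le_sum (f := x) (fun i _ => Nat.zero_le _) (Finset.mem_univ i)
      ext t
      simp only [Finset.mem_filter, Finset.mem_range]
      omega
    rw [this, Finset.card_range]
  have h1 : ∑ i, x i * x i ≤ ∑ i, x i * y i := by
    rw [hlayer, hlayer]
    exact Finset.sum_le_sum fun t _ => h.sum_superlevel_le hx t
  obtain ⟨j, hj⟩ := Function.ne_iff.1 hne
  have h2 : (0 : ℤ) < ∑ i, ((y i : ℤ) - x i) ^ 2 := by
    refine Finset.sum_pos' (fun i _ => sq_nonneg _) ⟨j, Finset.mem_univ _, ?_⟩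
    have : (y j : ℤ) - x j ≠ 0 := sub_ne_zero.2 (by exact_mod_cast hj.symm)
    positivity
  have h3 : ∑ i, ((y i : ℤ) - x i) ^ 2 =
      ∑ i, (y i : ℤ) * y i - 2 * ∑ i, (x i : ℤ) * y i + ∑ i, (x i : ℤ) * x i := by
    rw [Finset.mul_sum, ← Finset.sum_sub_distrib, ← Finset.sum_add_distrib]
    exact Finset.sum_congr rfl fun i _ => by ring
  zify at h1 ⊢
  linarith

lemma IsTreeDegreeSequence.exists_tree (h : IsTreeDegreeSequence x) :
    ∃ G : SimpleGraph (Fin n), G.IsTree ∧ ∀ i, deg G i = x i := by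
  obtain ⟨-, G, hG, hd⟩ := h
  exact ⟨G, hG, fun i => (deg_eq_ncard G i).trans (hd i)⟩

lemma IsTreeDegreeSequence.isBalanced (h : IsTreeDegreeSequence x) (hn : 2 ≤ n) :
    IsBalanced x := by
  classical
  obtain ⟨G, hG, hd⟩ := h.exists_tree
  refine ⟨h.1, fun i => ?_, ?_⟩
  · have : Nontrivial (Fin n) := Fin.nontrivial_iff_two_le.2 hn
    obtain ⟨u, hu⟩ := exists_ne i
    rw [← hd i]
    exact Finset.card_pos.2 ⟨toward G u i, by simp [(toward_spec hG.connected hu.symm).1]⟩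
  · simpa [hd] using (isTree_iff_sum_deg.1 hG).2

/-! ### Weighted sums over pairs of vertices -/

/-- In a tree the ordered pairs at distance two correspond to the vertices with two distinct
neighbours of theirs. -/
lemma card_dist_two {V : Type*} [Fintype V] {G : SimpleGraph V} (hG : G.IsTree) :
    (Finset.univ.filter fun e : V × V => G.dist e.1 e.2 = 2).card =
      ∑ c, (deg G c * deg G c - deg G c) := by
  classical
  simp only [deg, ← Finset.offDiag_card]
  rw [← Finset.card_sigma]
  symm
  refine Finset.card_bij (fun s _ => s.2) ?_ ?_ ?_
  · rintro ⟨c, u, w⟩ hs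
    simp only [Finset.mem_sigma, Finset.mem_univ, true_and, Finset.mem_offDiag,
      Finset.mem_filter] at hs ⊢
    have h1 : G.dist u c = 1 := dist_eq_one_iff_adj.2 hs.1.symm
    have h2 := hG.dist_eq_dist_add_one_of_adj u hs.2.1
    have h3 := hG.connected.pos_dist_of_ne hs.2.2
    omega
  · rintro ⟨c, u, w⟩ hs ⟨c', u', w'⟩ hs' heq
    simp only [Prod.mk.injEq] at heq
    obtain ⟨rfl, rfl⟩ := heq
    simp only [Finset.mem_sigma, Finset.mem_univ, true_and, Finset.mem_offDiag,
      Finset.mem_filter] at hs hs'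
    have h1 : G.dist u c = 1 := dist_eq_one_iff_adj.2 hs.1.symm
    have h1' : G.dist u c' = 1 := dist_eq_one_iff_adj.2 hs'.1.symm
    have h2 := hG.dist_eq_dist_add_one_of_adj u hs.2.1
    have h3 := hG.connected.pos_dist_of_ne hs.2.2
    have : c = c' := toward_unique hG (r := u) hs.2.1.symm hs'.2.1.symm (by omega) (by omega)
    rw [this]
  · rintro ⟨u, w⟩ hs
    simp only [Finset.mem_filter, Finset.mem_univ, true_and] at hs
    have hne : w ≠ u := by rintro rfl; simp at hs
    obtain ⟨h1, h2⟩ := toward_spec hG.connected hne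
    have h3 : G.Adj u (toward G u w) := dist_eq_one_iff_adj.1 (by omega)
    exact ⟨⟨toward G u w, u, w⟩, by simp [h3.symm, h1.symm, hne.symm], rfl⟩

lemma two_mul_wienerPsi (ψ : ℕ → ℝ) (G : SimpleGraph (Fin n)) :
    2 * wienerPsi ψ G = ∑ e : Fin n × Fin n with e.1 ≠ e.2, ψ (G.dist e.1 e.2) := by
  have h0 : (Finset.univ : Finset (Sym2 (Fin n))) = (Finset.univ : Finset (Fin n)).sym2 := by simp
  have h1 : wienerPsi ψ G = ∑ e : Fin n × Fin n with e.1 < e.2, ψ (G.dist e.1 e.2) := by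
    unfold wienerPsi
    rw [h0, Finset.sum_sym2_filter_not_isDiag]
    refine Finset.sum_congr ?_ fun e _ => rfl
    ext e
    simp only [Finset.mem_filter, Finset.mem_offDiag, Finset.mem_univ, true_and,
      and_iff_right_iff_imp]
    exact fun h => h.ne
  have h2 : wienerPsi ψ G = ∑ e : Fin n × Fin n with e.2 < e.1, ψ (G.dist e.1 e.2) := by
    rw [h1]
    refine Finset.sum_nbij' Prod.swap Prod.swap ?_ ?_ (by simp) (by simp) ?_
    · intro e he; simpa using he
    · intro e he; simpa using he
    · intro e _; rw [Prod.fst_swap, Prod.snd_swap, SimpleGraph.dist_comm]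
  have h3 : (Finset.univ.filter fun e : Fin n × Fin n => e.1 ≠ e.2) =
      (Finset.univ.filter fun e : Fin n × Fin n => e.1 < e.2) ∪
        Finset.univ.filter fun e : Fin n × Fin n => e.2 < e.1 := by
    ext e
    simp [lt_or_lt_iff_ne]
  rw [h3, Finset.sum_union, ← h1, ← h2, two_mul]
  rw [Finset.disjoint_filter]
  exact fun e _ h4 h5 => absurd h4 h5.asymm

/-- If the pairs of vertices of `G` can be matched with those of `G'` without increasing distances,
and the sums of the squared degrees differ, then strictly monotone weights are strictly separated. -/
lemma PairsCloser.wienerPsi_lt {G G' : SimpleGraph (Fin n)} (hG : G.IsTree) (hG' : G'.IsTree)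
    (h : PairsCloser G G') (hsq : ∑ c, (deg G c * deg G c - deg G c) ≠
      ∑ c, (deg G' c * deg G' c - deg G' c)) (ψ : ℕ → ℝ) :
    (StrictMonoOn ψ (Set.Ici 1) → wienerPsi ψ G' < wienerPsi ψ G) ∧
      (StrictAntiOn ψ (Set.Ici 1) → wienerPsi ψ G < wienerPsi ψ G') := by
  obtain ⟨Φ, hΦ⟩ := h
  -- Diagonal pairs are mapped to diagonal pairs, hence off-diagonal pairs to off-diagonal pairs.
  have hdiag : ∀ e, (Φ e).1 = (Φ e).2 ↔ e.1 = e.2 := by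
    have h1 : ∀ e, e.1 = e.2 → (Φ e).1 = (Φ e).2 := by
      intro e he
      have := hΦ e
      rw [he, SimpleGraph.dist_self] at this
      exact hG'.connected.dist_eq_zero_iff.1 (by omega)
    have h2 : (Finset.univ.filter fun e : Fin n × Fin n => e.1 = e.2).map Φ.toEmbedding =
        Finset.univ.filter fun e : Fin n × Fin n => e.1 = e.2 := by
      refine Finset.eq_of_subset_of_card_le ?_ (by rw [Finset.card_map])
      intro e he
      simp only [Finset.mem_map, Finset.mem_filter, Finset.mem_univ, true_and] at he ⊢
      obtain ⟨e', h3, rfl⟩ := he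
      exact h1 e' h3
    intro e
    refine ⟨fun h3 => ?_, h1 e⟩
    have h4 : Φ e ∈ Finset.univ.filter fun e : Fin n × Fin n => e.1 = e.2 := by simpa using h3
    rw [← h2] at h4
    simpa using h4
  have hpos : ∀ e : Fin n × Fin n, e.1 ≠ e.2 → 1 ≤ G'.dist (Φ e).1 (Φ e).2 := fun e he =>
    hG'.connected.pos_dist_of_ne fun h1 => he ((hdiag e).1 h1)
  have hre : 2 * wienerPsi ψ G' =
      ∑ e : Fin n × Fin n with e.1 ≠ e.2, ψ (G'.dist (Φ e).1 (Φ e).2) := by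
    rw [two_mul_wienerPsi]
    symm
    refine Finset.sum_nbij' Φ Φ.symm ?_ ?_ (fun e _ => Φ.symm_apply_apply e)
      (fun e _ => Φ.apply_symm_apply e) fun e _ => rfl
    · intro e he
      simp only [Finset.mem_filter, Finset.mem_univ, true_and, ne_eq] at he ⊢
      rwa [hdiag]
    · intro e he
      simp only [Finset.mem_filter, Finset.mem_univ, true_and, ne_eq] at he ⊢
      rwa [← hdiag, Φ.apply_symm_apply]
  -- If no distance decreased, the numbers of pairs at distance two would agree.
  obtain ⟨e₀, he₀⟩ : ∃ e, G'.dist (Φ e).1 (Φ e).2 < G.dist e.1 e.2 := by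
    by_contra hcon
    simp only [not_exists, not_lt] at hcon
    refine hsq ?_
    rw [← card_dist_two hG, ← card_dist_two hG']
    refine Finset.card_nbij' Φ Φ.symm ?_ ?_ (fun e _ => Φ.symm_apply_apply e)
      (fun e _ => Φ.apply_symm_apply e)
    · intro e he
      have := (hΦ e).antisymm (hcon e)
      simpa [this] using he
    · intro e he
      have := (hΦ (Φ.symm e)).antisymm (hcon _)
      rw [Φ.apply_symm_apply] at this
      simpa [this] using he
  have hne₀ : e₀.1 ≠ e₀.2 := by
    intro h1
    rw [h1, SimpleGraph.dist_self] at he₀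
    omega
  have hmem₀ : e₀ ∈ Finset.univ.filter fun e : Fin n × Fin n => e.1 ≠ e.2 := by simpa using hne₀
  have hG2 := two_mul_wienerPsi ψ G
  have hge : ∀ e : Fin n × Fin n, e.1 ≠ e.2 → 1 ≤ G.dist e.1 e.2 := fun e he =>
    (hpos e he).trans (hΦ e)
  constructor
  · intro hψ
    have : 2 * wienerPsi ψ G' < 2 * wienerPsi ψ G := by
      rw [hre, hG2]
      refine Finset.sum_lt_sum (fun e he => ?_)
        ⟨e₀, hmem₀, hψ (hpos e₀ hne₀) (hge e₀ hne₀) he₀⟩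
      have he' : e.1 ≠ e.2 := by simpa using he
      exact hψ.monotoneOn (hpos e he') (hge e he') (hΦ e)
    linarith
  · intro hψ
    have : 2 * wienerPsi ψ G < 2 * wienerPsi ψ G' := by
      rw [hre, hG2]
      refine Finset.sum_lt_sum (fun e he => ?_)
        ⟨e₀, hmem₀, hψ (hpos e₀ hne₀) (hge e₀ hne₀) he₀⟩
      have he' : e.1 ≠ e.2 := by simpa using he
      exact hψ.antitoneOn (hpos e he') (hge e he') (hΦ e)
    linarith

end GreedyTrees

/-- Distances between distinct vertices of a tree are positive integers, so only the values of `ψ`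
on the positive integers matter. -/
theorem theorem4p8 (n : ℕ) (π τ : Fin n → ℕ)
    (hπ : GreedyTrees.IsTreeDegreeSequence π) (hτ : GreedyTrees.IsTreeDegreeSequence τ)
    (hne : π ≠ τ) (hmaj : GreedyTrees.MajorizedBy π τ)
    (ψ : ℕ → ℝ) (hψ : ∀ k : ℕ, 1 ≤ k → 0 ≤ ψ k) :
    (StrictMonoOn ψ (Set.Ici 1) →
      GreedyTrees.wienerPsi ψ (GreedyTrees.greedyTree τ) <
        GreedyTrees.wienerPsi ψ (GreedyTrees.greedyTree π)) ∧
    (StrictAntiOn ψ (Set.Ici 1) →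
      GreedyTrees.wienerPsi ψ (GreedyTrees.greedyTree π) <
        GreedyTrees.wienerPsi ψ (GreedyTrees.greedyTree τ)) := by
  have hn : 2 ≤ n := by
    by_contra hn
    -- A sequence of length at most one is determined by its sum.
    refine hne (funext fun i => ?_)
    have : Subsingleton (Fin n) := Fin.subsingleton_iff_le_one.2 (by omega)
    have h1 := hmaj.2
    rwa [Fintype.sum_subsingleton _ i, Fintype.sum_subsingleton _ i] at h1
  obtain ⟨G, hG, hd⟩ := hπ.exists_tree
  obtain ⟨-, hTπ, hdπ⟩ := GreedyTrees.pairsCloser_greedyTree (hπ.isBalanced hn) hG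
    fun t => by simp only [hd, le_refl]
  obtain ⟨hcl, hTτ, hdτ⟩ := GreedyTrees.pairsCloser_greedyTree (hτ.isBalanced hn) hTπ
    fun t => by simpa only [hdπ] using hmaj.excess_le hπ.1 t
  refine hcl.wienerPsi_lt hTπ hTτ (fun heq => ?_) ψ
  simp only [hdπ, hdτ] at heq
  have key : ∀ x : Fin n → ℕ, ∑ i, (x i * x i - x i) + ∑ i, x i = ∑ i, x i * x i := by
    intro x
    rw [← Finset.sum_add_distrib]
    exact Finset.sum_congr rfl fun i _ => Nat.sub_add_cancel (Nat.le_mul_self _)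
  have h1 := key π
  have h2 := key τ
  have h3 := hmaj.2
  have h4 := hmaj.sum_sq_lt hπ.1 hne
  omega
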